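/- Let $(\theta_j)_{j\ge1}$, $(\kappa_j)_{j\ge1}$ be sequences of non-negative reals. For $N\in\mathbb N$ consider the surrogate-spatial measure on the symmetric group $\mathfrak S_N$ (permutations of $1,\dots,N$), $$\tilde{\mathbb P}_N(\sigma)=\frac{1}{N!\,H_N}\prod_{j=1}^N(\theta_j+N\kappa_j)^{C_j(\sigma)},\qquad H_N=\frac1{N!}\sum_{\sigma\in\mathfrak S_N}\prod_{j=1}^N(\theta_j+N\kappa_j)^{C_j(\sigma)},$$ where $C_j(\sigma)$ is the number of cycles of length $j$ of $\sigma$. Let $L_1$ be the length of the cycle containing $1$, $L_2$ the length of the cycle containing the smallest element not in that cycle, and so on ($L_j:=0$ if there are fewer than $j$ cycles). Put $g_\theta(z)=\sum_{j\ge1}\frac{\theta_j}{j}z^j$, $g_\kappa(z)=\sum_{j\ge1}\frac{\kappa_j}{j}z^j$, $g^{\{n\}}(z)=z^n\frac{d^ng}{dz^n}(z)$, let $R\in(0,\infty]$ be the radius of convergence of $g_\kappa$, assume that the radius of convergence of $g_\theta$ is at least $R$, and set $g^{\{n\}}(R)=\lim_{r\uparrow R}g^{\{n\}}(r)\in[0,\infty]$.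 Assume that no integer $j_0>1$ divides all $j$ with $\kappa_j\neq0$, and that $\kappa_j>0$ for some $j\ge2$. For finite $R$, $\eta>0$ and $0<\varphi<\pi/2$ let $$\Delta_0=\{z\in\mathbb C: |z|<R\,|1+\eta e^{i\varphi}|,\ z\ne R,\ |\arg(z-R)|>\varphi\}.$$ Assume that one of the following six conditions holds (in 2–6, $R<\infty$; in 2, 3, 5, 6, $g_\theta$ and $g_\kappa$ extend holomorphically to some such $\Delta_0$, the expansions hold as $z\to R$ in $\Delta_0$ for some $\delta>0$, and we write $u=1-z/R$): 1. (subcritical) $1<g_\kappa^{\{1\}}(R)\le\infty$. 2. (supercritical) $g_\kappa^{\{1\}}(R)<1$; for some $\theta^*>0$, $g_\theta(z)=-\theta^*\log u+O(u^\delta)$, and $g_\kappa(z)=g_\kappa(R)-g_\kappa^{\{1\}}(R)u+O(u^{1+\delta})$. 3. (supercritical) $g_\kappa^{\{1\}}(R)<1$; $g_\theta$ is regular at $z=R$; for some non-integer $s>1$ and real $a_s\ne0$, $g_\kappa^{\{n\}}(R)$ is finite for $n<s$ and infinite for $n>s$, and $g_\kappa(z)=\sum_{0\le n<s}\frac{(-1)^ng_\kappa^{\{n\}}(R)}{n!}u^n+a_su^s+O(u^{s+\delta})$.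 4. (critical) $g_\kappa^{\{1\}}(R)=1$, $g_\theta(R)<\infty$, $g_\kappa(R)<\infty$, $0<g_\kappa^{\{2\}}(R)<\infty$. 5. (critical) $g_\kappa^{\{1\}}(R)=1$, $0<g_\kappa^{\{2\}}(R)<\infty$; for some $\theta^*\ge0$, $g_\theta(z)=-\theta^*\log u+O(u^\delta)$, and $g_\kappa(z)=g_\kappa(R)-u+\frac12g_\kappa^{\{2\}}(R)u^2+O(u^{2+\delta})$. 6. (critical) $g_\kappa^{\{1\}}(R)=1$; for some $\theta^*\ge0$, $s\in(1,2)$, $a_s>0$, $g_\theta(z)=-\theta^*\log u+O(u^\delta)$ and $g_\kappa(z)=g_\kappa(R)-u+a_su^s+O(u^{s+\delta})$. Then $H_N>0$ for all large $N$, and there is exactly one real $r_*>0$, $r_*\le R$, such that $g_\kappa^{\{1\}}(r_*)=1$ if $g_\kappa^{\{1\}}(R)\ge1$, and $r_*=R$ if $g_\kappa^{\{1\}}(R)<1$. For every $m\ge1$ the following hold. (a) For all $\ell_1,\dots,\ell_m\in\mathbb N$, without any normalization, $$\lim_{N\to\infty}\tilde{\mathbb P}_N\{L_1=\ell_1,\dots,L_m=\ell_m\}=\prod_{j=1}^m\kappa_{\ell_j}r_*^{\ell_j}.$$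 (b) $L_1,\dots,L_m$ are asymptotically independent in the following sense. For every $M$ such that $\kappa_j>0$ for some $j\le M$, they are asymptotically independent conditionally on the event $E_M=\{L_1\le M,\dots,L_m\le M\}$: for all $\ell_1,\dots,\ell_m\in\mathbb N$, $$\tilde{\mathbb P}_N\{L_1=\ell_1,\dots,L_m=\ell_m\mid E_M\}-\prod_{j=1}^m\tilde{\mathbb P}_N\{L_j=\ell_j\mid E_M\}\to0\qquad(N\to\infty).$$ If $g_\kappa^{\{1\}}(R)\ge1$, they are also unconditionally asymptotically independent: for all sets $A_1,\dots,A_m\subseteq\{0,1,2,\dots\}$, $\tilde{\mathbb P}_N\{L_1\in A_1,\dots,L_m\in A_m\}-\prod_{j=1}^m\tilde{\mathbb P}_N\{L_j\in A_j\}\to0$. (c) If $g_\kappa^{\{1\}}(R)\ge1$, the limit in (a) is a proper probability distribution on $\mathbb N^m$ (total mass $1$); if $g_\kappa^{\{1\}}(R)<1$, it is defective, with total mass $\bigl(g_\kappa^{\{1\}}(R)\bigr)^m<1$. -/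

import Mathlib

open Filter Topology Asymptotics
open scoped ENNReal

noncomputable section

namespace SurrogateSpatial

/-! ### The surrogate-spatial measure on permutations -/

/-- The number `C_j(σ)` of cycles of length `j` of `σ` (fixed points are cycles of length one). -/
def cycleCount {N : ℕ} (σ : Equiv.Perm (Fin N)) (j : ℕ) : ℕ :=
  σ.partition.parts.count j

/-- The unnormalized weight `∏_{j=1}^N (θ_j + N κ_j)^{C_j(σ)}`. -/
def cycleWeight (θ κ : ℕ → ℝ) (N : ℕ) (σ : Equiv.Perm (Fin N)) : ℝ :=
  ∏ j ∈ Finset.Icc 1 N, (θ j + N * κ j) ^ cycleCount σ j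

/-- The normalization `H_N = (1 / N!) ∑_σ ∏_j (θ_j + N κ_j)^{C_j(σ)}`. -/
def normConst (θ κ : ℕ → ℝ) (N : ℕ) : ℝ :=
  (1 / (N.factorial : ℝ)) * ∑ σ : Equiv.Perm (Fin N), cycleWeight θ κ N σ

/-- The mass of the single permutation `σ` (meaningful when `H_N > 0`). -/
def permMass (θ κ : ℕ → ℝ) (N : ℕ) (σ : Equiv.Perm (Fin N)) : ℝ :=
  cycleWeight θ κ N σ / ((N.factorial : ℝ) * normConst θ κ N)

open Classical in
/-- The probability of the event `A`. -/
def prob (θ κ : ℕ → ℝ) (N : ℕ) (A : Set (Equiv.Perm (Fin N))) : ℝ :=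
  ∑ σ : Equiv.Perm (Fin N), if σ ∈ A then permMass θ κ N σ else 0

/-- The elementary conditional probability of `A` given `B`. -/
def condProb (θ κ : ℕ → ℝ) (N : ℕ) (A B : Set (Equiv.Perm (Fin N))) : ℝ :=
  prob θ κ N (A ∩ B) / prob θ κ N B

/-! ### Lexicographically ordered cycle lengths -/

open Classical in
/-- The set of elements that remain after the first `k` lexicographically ordered cycles have been
removed: at each step one removes the cycle containing the smallest remaining element. -/
def remaining {N : ℕ} (σ : Equiv.Perm (Fin N)) : ℕ → Finset (Fin N)
  | 0 => Finset.univ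
  | k + 1 =>
    if h : (remaining σ k).Nonempty then
      (remaining σ k).filter fun x => ¬ σ.SameCycle ((remaining σ k).min' h) x
    else ∅

open Classical in
/-- The length `L_{k+1}(σ)` of the `(k+1)`-st cycle in the lexicographic order, that is, of the cycle
containing the smallest element that lies in none of the first `k` cycles; it is `0` if `σ` has at
most `k` cycles. -/
def lexLength {N : ℕ} (σ : Equiv.Perm (Fin N)) (k : ℕ) : ℕ :=
  if h : (remaining σ k).Nonempty then
    (Finset.univ.filter fun x => σ.SameCycle ((remaining σ k).min' h) x).card
  else 0

/-! ### Generating functions -/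

/-- The coefficients of `g_a(z) = ∑_{j ≥ 1} (a_j / j) z^j`. -/
def genCoeff (a : ℕ → ℝ) (j : ℕ) : ℝ := if j = 0 then 0 else a j / j

/-- The radius of convergence of `g_a`. -/
def genRadius (a : ℕ → ℝ) : ℝ≥0∞ :=
  (FormalMultilinearSeries.ofScalars ℂ fun j => ((genCoeff a j : ℝ) : ℂ)).radius

/-- The sum `g_a(z)` of the series (meaningful inside the disk of convergence). -/
def genFun (a : ℕ → ℝ) (z : ℂ) : ℂ := ∑' j : ℕ, ((genCoeff a j : ℝ) : ℂ) * z ^ j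

/-- The modified derivative `g_a^{\{n\}}(r) = r^n g_a^{(n)}(r)` at a point `r` of `[0, R]`, where `R` is
the radius of convergence, as an element of `[0, ∞]`.  For `a ≥ 0` it is the sum of the termwise
differentiated series; by monotone convergence its value at `r = R` (also if `R = ∞`) is the limit
of `g_a^{\{n\}}(r)` as `r ↑ R`. -/
def modDeriv (a : ℕ → ℝ) (n : ℕ) (r : ℝ≥0∞) : ℝ≥0∞ :=
  ∑' j : ℕ, (j.descFactorial n : ℝ≥0∞) * ENNReal.ofReal (genCoeff a j) * r ^ j

/-- Non-arithmetic: there is no integer `j₀ > 1` that divides all `j ≥ 1` with `κ_j ≠ 0`. -/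
def NonArithmetic (κ : ℕ → ℝ) : Prop :=
  ¬ ∃ j₀ : ℕ, 1 < j₀ ∧ ∀ j : ℕ, 1 ≤ j → κ j ≠ 0 → j₀ ∣ j

/-- `r = r_*`: the root in `(0, R]` of `g_κ^{\{1\}}(r) = 1` if `g_κ^{\{1\}}(R) ≥ 1`, and `r = R`
if `g_κ^{\{1\}}(R) < 1`. -/
def IsRStar (κ : ℕ → ℝ) (r : ℝ) : Prop :=
  0 < r ∧ ENNReal.ofReal r ≤ genRadius κ ∧
    (1 ≤ modDeriv κ 1 (genRadius κ) → modDeriv κ 1 (ENNReal.ofReal r) = 1) ∧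
    (modDeriv κ 1 (genRadius κ) < 1 → ENNReal.ofReal r = genRadius κ)

/-! ### Analytic conditions -/

/-- The domain `Δ₀(R, η, φ)`: a disk of radius larger than `R` with a sector at `R` cut out. -/
def deltaDomain (R η φ : ℝ) : Set ℂ :=
  {z : ℂ | ‖z‖ < ‖(R : ℂ) * (1 + η * Complex.exp (Complex.I * φ))‖ ∧ z ≠ (R : ℂ) ∧
    φ < |Complex.arg (z - R)|}

/-- `F` is a holomorphic continuation to `D` of `g_a`, given by its series in `|z| < R`. -/
def ContinuesTo (a : ℕ → ℝ) (R : ℝ) (D : Set ℂ) (F : ℂ → ℂ) : Prop :=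
  ENNReal.ofReal R ≤ genRadius a ∧ DifferentiableOn ℂ F D ∧ ∀ z : ℂ, ‖z‖ < R → F z = genFun a z

/-- `F(z) = -θ* log(1 - z/R) + O((1 - z/R)^δ)` as `z → R`, `z ∈ D`. -/
def LogExpansion (F : ℂ → ℂ) (R : ℝ) (D : Set ℂ) (θs δ : ℝ) : Prop :=
  (fun z : ℂ => F z - (-(θs : ℂ) * Complex.log (1 - z / R))) =O[𝓝[D] (R : ℂ)]
    fun z : ℂ => ‖1 - z / R‖ ^ δ

/-- Subcritical case: `1 < g_κ^{\{1\}}(R) ≤ ∞` (here `R = ∞` is allowed). -/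
def Subcritical (θ κ : ℕ → ℝ) : Prop :=
  0 < genRadius κ ∧ genRadius κ ≤ genRadius θ ∧ 1 < modDeriv κ 1 (genRadius κ)

/-- Supercritical case with a logarithmic singularity of `g_θ`. -/
def SupercriticalLog (θ κ : ℕ → ℝ) : Prop :=
  ∃ (R η φ θs δ : ℝ) (Fθ Fκ : ℂ → ℂ),
    0 < R ∧ genRadius κ = ENNReal.ofReal R ∧
    0 < η ∧ 0 < φ ∧ φ < Real.pi / 2 ∧ 0 < θs ∧ 0 < δ ∧
    ContinuesTo θ R (deltaDomain R η φ) Fθ ∧ ContinuesTo κ R (deltaDomain R η φ) Fκ ∧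
    modDeriv κ 1 (ENNReal.ofReal R) < 1 ∧
    LogExpansion Fθ R (deltaDomain R η φ) θs δ ∧
    (fun z : ℂ => Fκ z - ((modDeriv κ 0 (ENNReal.ofReal R)).toReal
        - (modDeriv κ 1 (ENNReal.ofReal R)).toReal * (1 - z / R)))
      =O[𝓝[deltaDomain R η φ] (R : ℂ)] fun z : ℂ => ‖1 - z / R‖ ^ (1 + δ)

/-- Supercritical case with `g_θ` regular at `R` and a power singularity of `g_κ` of non-integer
order `s > 1`. -/
def SupercriticalPower (θ κ : ℕ → ℝ) : Prop :=
  ∃ (R η φ s as δ : ℝ) (Fθ Fκ : ℂ → ℂ),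
    0 < R ∧ genRadius κ = ENNReal.ofReal R ∧
    0 < η ∧ 0 < φ ∧ φ < Real.pi / 2 ∧ 0 < δ ∧
    1 < s ∧ (∀ k : ℕ, s ≠ k) ∧ as ≠ 0 ∧
    ContinuesTo θ R (deltaDomain R η φ) Fθ ∧ AnalyticAt ℂ Fθ (R : ℂ) ∧
    ContinuesTo κ R (deltaDomain R η φ) Fκ ∧
    modDeriv κ 1 (ENNReal.ofReal R) < 1 ∧
    (∀ n : ℕ, (n : ℝ) < s → modDeriv κ n (ENNReal.ofReal R) < ∞) ∧
    (∀ n : ℕ, s < (n : ℝ) → modDeriv κ n (ENNReal.ofReal R) = ∞) ∧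
    (fun z : ℂ => Fκ z
        - (∑ n ∈ Finset.range ⌈s⌉₊,
            (-1 : ℂ) ^ n * ((modDeriv κ n (ENNReal.ofReal R)).toReal : ℂ) / (n.factorial : ℂ)
              * (1 - z / R) ^ n
          + (as : ℂ) * (1 - z / R) ^ (s : ℂ)))
      =O[𝓝[deltaDomain R η φ] (R : ℂ)] fun z : ℂ => ‖1 - z / R‖ ^ (s + δ)

/-- Critical case with `g_θ(R) < ∞` and finite second derivative of `g_κ` at `R`. -/
def CriticalRegular (θ κ : ℕ → ℝ) : Prop :=
  ∃ R : ℝ, 0 < R ∧ genRadius κ = ENNReal.ofReal R ∧ ENNReal.ofReal R ≤ genRadius θ ∧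
    modDeriv θ 0 (ENNReal.ofReal R) < ∞ ∧ modDeriv κ 0 (ENNReal.ofReal R) < ∞ ∧
    modDeriv κ 1 (ENNReal.ofReal R) = 1 ∧
    0 < modDeriv κ 2 (ENNReal.ofReal R) ∧ modDeriv κ 2 (ENNReal.ofReal R) < ∞

/-- Critical case with a (possibly absent) logarithmic singularity of `g_θ` and finite second
derivative of `g_κ` at `R`. -/
def CriticalLog (θ κ : ℕ → ℝ) : Prop :=
  ∃ (R η φ θs δ : ℝ) (Fθ Fκ : ℂ → ℂ),
    0 < R ∧ genRadius κ = ENNReal.ofReal R ∧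
    0 < η ∧ 0 < φ ∧ φ < Real.pi / 2 ∧ 0 ≤ θs ∧ 0 < δ ∧
    ContinuesTo θ R (deltaDomain R η φ) Fθ ∧ ContinuesTo κ R (deltaDomain R η φ) Fκ ∧
    modDeriv κ 1 (ENNReal.ofReal R) = 1 ∧
    0 < modDeriv κ 2 (ENNReal.ofReal R) ∧ modDeriv κ 2 (ENNReal.ofReal R) < ∞ ∧
    LogExpansion Fθ R (deltaDomain R η φ) θs δ ∧
    (fun z : ℂ => Fκ z - ((modDeriv κ 0 (ENNReal.ofReal R)).toReal - (1 - z / R)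
        + (modDeriv κ 2 (ENNReal.ofReal R)).toReal / 2 * (1 - z / R) ^ 2))
      =O[𝓝[deltaDomain R η φ] (R : ℂ)] fun z : ℂ => ‖1 - z / R‖ ^ (2 + δ)

/-- Critical case with a (possibly absent) logarithmic singularity of `g_θ` and a power singularity
of `g_κ` of order `s ∈ (1, 2)`. -/
def CriticalPower (θ κ : ℕ → ℝ) : Prop :=
  ∃ (R η φ θs s as δ : ℝ) (Fθ Fκ : ℂ → ℂ),
    0 < R ∧ genRadius κ = ENNReal.ofReal R ∧
    0 < η ∧ 0 < φ ∧ φ < Real.pi / 2 ∧ 0 ≤ θs ∧ 0 < δ ∧ 1 < s ∧ s < 2 ∧ 0 < as ∧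
    ContinuesTo θ R (deltaDomain R η φ) Fθ ∧ ContinuesTo κ R (deltaDomain R η φ) Fκ ∧
    modDeriv κ 1 (ENNReal.ofReal R) = 1 ∧
    LogExpansion Fθ R (deltaDomain R η φ) θs δ ∧
    (fun z : ℂ => Fκ z - ((modDeriv κ 0 (ENNReal.ofReal R)).toReal - (1 - z / R)
        + (as : ℂ) * (1 - z / R) ^ (s : ℂ)))
      =O[𝓝[deltaDomain R η φ] (R : ℂ)] fun z : ℂ => ‖1 - z / R‖ ^ (s + δ)

/-- The standing analytic hypothesis: one of the six sets of conditions holds. -/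
def AnalyticConditions (θ κ : ℕ → ℝ) : Prop :=
  Subcritical θ κ ∨ SupercriticalLog θ κ ∨ SupercriticalPower θ κ ∨
    CriticalRegular θ κ ∨ CriticalLog θ κ ∨ CriticalPower θ κ

end SurrogateSpatial

end

noncomputable section

namespace SurrogateSpatial

/-! ### Sums over permutations by cycle type -/

/-! The normalization is the coefficient of `z ^ N` in `exp (g_θ(z) + N g_κ(z))`. All six cases are
treated at once by finding its growth on the exponential scale, which is governed by the radius `r =
r_*`: the rate is `g_κ(r) - log r`.

For the upper bound, a nonnegative coefficient is at most the value of the function divided by `x ^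
N`, for `x` slightly below `r` (`cycleSum_mul_pow_le`). For the lower bound a single cycle type
suffices: about `N κ_j x ^ j / j` cycles of each length `j ≤ J`, with `x` chosen so that these use
up almost all `N` elements, and a bounded remainder filled by means of the non-arithmetic condition
(`exists_le_normConst`, `eventually_le_normConst`).

Tilting by `exp (s C_l)` multiplies the weight of length `l` by `exp s`, so the same two bounds
estimate the moment generating function of `C_l` on the exponential scale. A Chernoff argument then
makes `C_l / N` converge in `L¹` to the constant `κ_l r ^ l / l` (`tendsto_mean_abs_cycleCount`).

The measure is invariant under conjugation. Hence `m` fixed distinct points behave like `m` uniform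
random points, which given `σ` lie in cycles of lengths `ℓ_i` with probability `∏ ℓ_i C_{ℓ_i} / N`,
up to coincidences. The mean of this product tends to `∏ κ_{ℓ_i} r ^ ℓ_i`. The first `m` elements
rarely share a short cycle, so the lexicographic lengths have the same limit
(`tendsto_prob_lexLength_eq`).

Independence follows because the limit is a product; for arbitrary sets it also needs total mass
one, so that no mass escapes to infinity (`tendsto_prob_lexLength_mem`). -/

lemma filter_two_le_add_replicate {n : ℕ} (p : n.Partition) :
    p.parts = p.parts.filter (2 ≤ ·) + Multiset.replicate (p.parts.count 1) 1 := by
  ext j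
  rw [Multiset.count_add, Multiset.count_filter, Multiset.count_replicate]
  by_cases hj : j ∈ p.parts
  · have := p.parts_pos hj
    by_cases h1 : j = 1
    · subst h1; simp
    · rw [if_pos (by omega), if_neg (by omega)]; simp
  · rw [Multiset.count_eq_zero_of_notMem hj]
    by_cases h1 : 1 = j
    · subst h1; simp [hj]
    · simp [h1]

lemma count_one_add_sum {n : ℕ} (p : n.Partition) :
    (p.parts.filter (2 ≤ ·)).sum + p.parts.count 1 = n := by
  have h := congrArg Multiset.sum (filter_two_le_add_replicate p)
  rw [p.parts_sum, Multiset.sum_add, Multiset.sum_replicate, smul_eq_mul, mul_one] at h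
  exact h.symm

/-- The two descriptions differ only by the fixed points, whose number is forced by the total size.
-/
lemma partition_eq_iff_cycleType {α : Type*} [Fintype α] [DecidableEq α] (σ : Equiv.Perm α)
    (p : (Fintype.card α).Partition) :
    σ.partition = p ↔ σ.cycleType = p.parts.filter (2 ≤ ·) := by
  constructor
  · rintro rfl
    exact Equiv.Perm.filter_parts_partition_eq_cycleType.symm
  · intro h
    have h1 := count_one_add_sum p
    ext1
    rw [Equiv.Perm.parts_partition, ← Equiv.Perm.sum_cycleType, h]
    conv_rhs => rw [filter_two_le_add_replicate p]
    congr 2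
    omega

/-- Cauchy's formula for the size of a conjugacy class. In the formula for cycle types, the
factorial of the number of fixed points stands apart; here it becomes the factor `j = 1` of the
product. -/
lemma card_partition_mul {α : Type*} [Fintype α] [DecidableEq α]
    (p : (Fintype.card α).Partition) :
    (Finset.univ.filter fun σ : Equiv.Perm α => σ.partition = p).card *
      ∏ j ∈ Finset.Icc 1 (Fintype.card α), (j ^ p.parts.count j * (p.parts.count j).factorial) =
      (Fintype.card α).factorial := by
  set m := p.parts.filter (2 ≤ ·) with hm
  have h1 := count_one_add_sum p
  rw [← hm] at h1
  have key := Equiv.Perm.card_of_cycleType_mul_eq α m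
  rw [if_pos ⟨by omega, fun a ha => (Multiset.mem_filter.1 ha).2⟩] at key
  have hset : (Finset.univ.filter fun σ : Equiv.Perm α => σ.partition = p) =
      Finset.univ.filter fun σ : Equiv.Perm α => σ.cycleType = m := by
    ext σ
    simp [partition_eq_iff_cycleType σ p, hm]
  rw [hset, ← key]
  congr 1
  have h2 : Fintype.card α - m.sum = p.parts.count 1 := by omega
  rw [h2, mul_assoc, Finset.prod_multiset_count, ← Finset.prod_mul_distrib]
  have hsub : m.toFinset ⊆ Finset.Icc 1 (Fintype.card α) := by
    intro j hj
    rw [Multiset.mem_toFinset] at hj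
    have hj' := (Multiset.mem_filter.1 hj).1
    exact Finset.mem_Icc.2 ⟨p.parts_pos hj', p.le_of_mem_parts hj'⟩
  rw [Finset.prod_subset hsub (f := fun j => j ^ m.count j * (m.count j).factorial)]
  · have : ∏ j ∈ Finset.Icc 1 (Fintype.card α), (if j = 1 then (p.parts.count 1).factorial else 1) =
        (p.parts.count 1).factorial := by
      rw [Finset.prod_ite_eq']
      split_ifs with h
      · rfl
      · have : p.parts.count 1 = 0 := by
          simp at h; omega
        rw [this]; rfl
    rw [← this, ← Finset.prod_mul_distrib]
    refine Finset.prod_congr rfl fun j hj => ?_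
    have hj1 := (Finset.mem_Icc.1 hj).1
    by_cases h : j = 1
    · subst h
      have : m.count 1 = 0 := by rw [hm, Multiset.count_filter]; simp
      simp [this]
    · have : m.count j = p.parts.count j := by
        rw [hm, Multiset.count_filter, if_pos (by omega)]
      rw [this, if_neg h, one_mul]
  · intro j _ hj
    rw [Multiset.mem_toFinset] at hj
    simp [Multiset.count_eq_zero_of_notMem hj]

/-- The cycle index `(1 / N!) ∑_σ ∏_{j=1}^N w_j^{C_j(σ)}` at the weights `w`. -/
def cycleSum (w : ℕ → ℝ) (N : ℕ) : ℝ :=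
  (1 / (N.factorial : ℝ)) * ∑ σ : Equiv.Perm (Fin N), ∏ j ∈ Finset.Icc 1 N, w j ^ cycleCount σ j

lemma normConst_eq_cycleSum (θ κ : ℕ → ℝ) (N : ℕ) :
    normConst θ κ N = cycleSum (fun j => θ j + N * κ j) N := rfl

/-- The weight depends only on the cycle type, so Cauchy's formula turns the sum into products of
Poisson-type terms, that is, into the coefficient of `z ^ N` in `exp (∑ w_j z ^ j / j)`. -/
lemma cycleSum_eq_sum_partition (w : ℕ → ℝ) (N : ℕ) :
    cycleSum w N = ∑ p : (Fintype.card (Fin N)).Partition, ∏ j ∈ Finset.Icc 1 N,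
      (w j / j) ^ p.parts.count j / (p.parts.count j).factorial := by
  unfold cycleSum
  rw [← Finset.sum_fiberwise Finset.univ (fun σ : Equiv.Perm (Fin N) => σ.partition),
    Finset.mul_sum]
  refine Finset.sum_congr rfl fun p _ => ?_
  have h1 : ∑ σ : Equiv.Perm (Fin N) with σ.partition = p,
      ∏ j ∈ Finset.Icc 1 N, w j ^ cycleCount σ j =
      (Finset.univ.filter fun σ : Equiv.Perm (Fin N) => σ.partition = p).card *
        ∏ j ∈ Finset.Icc 1 N, w j ^ p.parts.count j := by
    rw [← nsmul_eq_mul, ← Finset.sum_const]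
    refine Finset.sum_congr rfl fun σ hσ => ?_
    rw [Finset.mem_filter] at hσ
    simp only [cycleCount, hσ.2]
  have h2 := congrArg (Nat.cast (R := ℝ)) (card_partition_mul p)
  push_cast at h2
  simp only [Fintype.card_fin] at h2
  have hD : (∏ j ∈ Finset.Icc 1 N, ((j : ℝ) ^ p.parts.count j * (p.parts.count j).factorial)) ≠ 0 := by
    refine Finset.prod_ne_zero_iff.2 fun j hj => ?_
    have := (Finset.mem_Icc.1 hj).1
    positivity
  have hN : (N.factorial : ℝ) ≠ 0 := by positivity
  have h3 : ∏ j ∈ Finset.Icc 1 N, (w j / j) ^ p.parts.count j / (p.parts.count j).factorial =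
      (∏ j ∈ Finset.Icc 1 N, w j ^ p.parts.count j) /
        ∏ j ∈ Finset.Icc 1 N, ((j : ℝ) ^ p.parts.count j * (p.parts.count j).factorial) := by
    rw [← Finset.prod_div_distrib]
    refine Finset.prod_congr rfl fun j _ => ?_
    rw [div_pow, div_div]
  rw [h1, h3, eq_div_iff hD, ← h2]
  have hc : ((Finset.univ.filter fun σ : Equiv.Perm (Fin N) => σ.partition = p).card : ℝ) ≠ 0 := by
    intro h; rw [h, zero_mul] at h2; exact hN h2.symm
  field_simp

lemma sum_mul_count_partition {N : ℕ} (p : (Fintype.card (Fin N)).Partition) :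
    ∑ j ∈ Finset.Icc 1 N, j * p.parts.count j = N := by
  have h := p.parts_sum.trans (Fintype.card_fin N)
  rw [Finset.sum_multiset_count] at h
  refine Eq.trans ?_ h
  symm
  simp only [smul_eq_mul, mul_comm]
  refine Finset.sum_subset ?_ ?_
  · intro j hj
    rw [Multiset.mem_toFinset] at hj
    have := p.le_of_mem_parts hj
    rw [Fintype.card_fin] at this
    exact Finset.mem_Icc.2 ⟨p.parts_pos hj, this⟩
  · intro j _ hj
    rw [Multiset.mem_toFinset] at hj
    simp [Multiset.count_eq_zero_of_notMem hj]

/-- All terms are nonnegative, so the sum over partitions may be enlarged to all count vectors with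
entries at most `N`. The enlarged sum factors into truncated exponential series. -/
lemma cycleSum_mul_pow_le (w : ℕ → ℝ) (N : ℕ) (hw : ∀ j, 1 ≤ j → 0 ≤ w j) {x : ℝ} (hx : 0 ≤ x) :
    cycleSum w N * x ^ N ≤ Real.exp (∑ j ∈ Finset.Icc 1 N, w j * x ^ j / j) := by
  classical
  set s := Finset.Icc 1 N with hs
  have hlam : ∀ j ∈ s, 0 ≤ w j * x ^ j / j := fun j hj => by
    have := hw j (Finset.mem_Icc.1 hj).1
    positivity
  let F : (∀ j ∈ s, ℕ) → ℝ := fun c => ∏ j ∈ s.attach,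
    (w j * x ^ (j : ℕ) / (j : ℕ)) ^ c j j.2 / (c j j.2).factorial
  let φ : (Fintype.card (Fin N)).Partition → (∀ j ∈ s, ℕ) := fun p j _ => p.parts.count j
  have hφ : Function.Injective φ := by
    intro p q h
    ext1
    ext j
    by_cases hj : j ∈ s
    · exact congrFun (congrFun h j) hj
    · have aux : ∀ p : (Fintype.card (Fin N)).Partition, p.parts.count j = 0 := by
        intro p
        refine Multiset.count_eq_zero_of_notMem fun hm => hj ?_
        have := p.le_of_mem_parts hm
        rw [Fintype.card_fin] at this
        exact Finset.mem_Icc.2 ⟨p.parts_pos hm, this⟩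
      rw [aux, aux]
  have h1 : cycleSum w N * x ^ N = ∑ p : (Fintype.card (Fin N)).Partition, F (φ p) := by
    rw [cycleSum_eq_sum_partition, Finset.sum_mul]
    refine Finset.sum_congr rfl fun p _ => ?_
    have hxN : x ^ N = ∏ j ∈ Finset.Icc 1 N, x ^ (j * p.parts.count j) := by
      rw [Finset.prod_pow_eq_pow_sum, sum_mul_count_partition p]
    rw [hxN, ← Finset.prod_mul_distrib]
    simp only [F, φ]
    rw [Finset.prod_attach s (fun j => (w j * x ^ j / j) ^ p.parts.count j /
      (p.parts.count j).factorial)]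
    refine Finset.prod_congr rfl fun j _ => ?_
    rw [div_pow, div_pow, mul_pow, pow_mul]
    ring
  have h2 : ∑ p : (Fintype.card (Fin N)).Partition, F (φ p) ≤
      ∑ c ∈ s.pi (fun _ => Finset.range (N + 1)), F c := by
    rw [← Finset.sum_image (f := F) (s := Finset.univ) (g := φ) (fun _ _ _ _ h => hφ h)]
    refine Finset.sum_le_sum_of_subset_of_nonneg ?_ ?_
    · intro c hc
      obtain ⟨p, -, rfl⟩ := Finset.mem_image.1 hc
      refine Finset.mem_pi.2 fun j hj => Finset.mem_range.2 ?_
      have h := Finset.single_le_sum (f := fun j => j * p.parts.count j) (fun _ _ => Nat.zero_le _) hj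
      rw [sum_mul_count_partition] at h
      have := (Finset.mem_Icc.1 hj).1
      simp only [φ]
      nlinarith
    · intro c _ _
      refine Finset.prod_nonneg fun j _ => ?_
      have := hlam j j.2
      positivity
  rw [h1]
  refine h2.trans ?_
  have h3 := Finset.prod_sum s (fun _ => Finset.range (N + 1))
    (fun j c => (w j * x ^ j / j) ^ c / (c.factorial : ℝ))
  refine h3.symm.le.trans ?_
  rw [Real.exp_sum]
  refine Finset.prod_le_prod (fun j hj => Finset.sum_nonneg fun c _ => ?_) fun j hj => ?_
  · have := hlam j hj
    positivity
  · exact Real.sum_le_exp_of_nonneg (hlam j hj) _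

/-- One cycle type alone bounds a sum of nonnegative terms from below. -/
lemma le_cycleSum (w : ℕ → ℝ) (N : ℕ) (hw : ∀ j, 1 ≤ j → 0 ≤ w j) (c : ℕ → ℕ)
    (hc : ∑ j ∈ Finset.Icc 1 N, j * c j = N) :
    ∏ j ∈ Finset.Icc 1 N, (w j / j) ^ c j / (c j).factorial ≤ cycleSum w N := by
  rw [cycleSum_eq_sum_partition]
  let p : (Fintype.card (Fin N)).Partition :=
    { parts := ∑ j ∈ Finset.Icc 1 N, Multiset.replicate (c j) j
      parts_pos := by
        intro i hi
        rw [Multiset.mem_sum] at hi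
        obtain ⟨j, hj, hij⟩ := hi
        rw [Multiset.eq_of_mem_replicate hij]
        exact (Finset.mem_Icc.1 hj).1
      parts_sum := by
        rw [Multiset.sum_sum]
        simp only [Multiset.sum_replicate, smul_eq_mul, Fintype.card_fin]
        conv_rhs => rw [← hc]
        exact Finset.sum_congr rfl fun j _ => mul_comm _ _ }
  have hp : ∀ j ∈ Finset.Icc 1 N, p.parts.count j = c j := by
    intro j hj
    simp only [p, Multiset.count_sum', Multiset.count_replicate]
    rw [Finset.sum_ite_eq', if_pos hj]
  have := Finset.single_le_sum (s := Finset.univ)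
    (f := fun p : (Fintype.card (Fin N)).Partition => ∏ j ∈ Finset.Icc 1 N,
      (w j / j) ^ p.parts.count j / ((p.parts.count j).factorial : ℝ))
    (fun q _ => Finset.prod_nonneg fun j hj => by
      have := hw j (Finset.mem_Icc.1 hj).1
      positivity) (Finset.mem_univ p)
  refine le_trans (le_of_eq ?_) this
  refine Finset.prod_congr rfl fun j hj => ?_
  rw [hp j hj]

/-! ### Lengths of the cycles of given elements -/

open Classical in
/-- The length of the cycle of `σ` that contains `x`. -/
def cycleLength {N : ℕ} (σ : Equiv.Perm (Fin N)) (x : Fin N) : ℕ :=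
  (Finset.univ.filter fun y => σ.SameCycle x y).card

lemma cycleLength_pos {N : ℕ} (σ : Equiv.Perm (Fin N)) (x : Fin N) : 0 < cycleLength σ x := by
  classical
  exact Finset.card_pos.2 ⟨x, by simp [Equiv.Perm.SameCycle.refl]⟩

lemma cycleLength_eq_of_sameCycle {N : ℕ} {σ : Equiv.Perm (Fin N)} {x y : Fin N}
    (h : σ.SameCycle x y) : cycleLength σ x = cycleLength σ y := by
  classical
  unfold cycleLength
  congr 1
  ext z
  simp only [Finset.mem_filter, Finset.mem_univ, true_and]
  exact ⟨fun hz => h.symm.trans hz, fun hz => h.trans hz⟩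

lemma cycleLength_conj {N : ℕ} (σ τ : Equiv.Perm (Fin N)) (x : Fin N) :
    cycleLength (τ * σ * τ⁻¹) (τ x) = cycleLength σ x := by
  classical
  unfold cycleLength
  symm
  refine Finset.card_bij (fun y _ => τ y) ?_ ?_ ?_
  · intro y hy
    simpa [Equiv.Perm.sameCycle_conj] using hy
  · intro a _ b _ h
    exact τ.injective h
  · intro y hy
    refine ⟨τ⁻¹ y, ?_, by simp⟩
    simpa [Equiv.Perm.sameCycle_conj] using hy

lemma cycleLength_eq_one_iff {N : ℕ} (σ : Equiv.Perm (Fin N)) (x : Fin N) :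
    cycleLength σ x = 1 ↔ σ x = x := by
  classical
  unfold cycleLength
  constructor
  · intro h
    have := Finset.card_le_one.1 h.le x (by simp [Equiv.Perm.SameCycle.refl]) (σ x)
      (by simp [Equiv.Perm.sameCycle_apply_right, Equiv.Perm.SameCycle.refl])
    exact this.symm
  · intro h
    rw [Finset.card_eq_one]
    refine ⟨x, ?_⟩
    ext y
    simp only [Finset.mem_filter, Finset.mem_univ, true_and, Finset.mem_singleton]
    constructor
    · intro hy
      exact (hy.eq_of_left h).symm
    · rintro rfl
      exact Equiv.Perm.SameCycle.refl _ _

lemma cycleLength_eq_card_support_cycleOf {N : ℕ} (σ : Equiv.Perm (Fin N)) {x : Fin N}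
    (hx : σ x ≠ x) : cycleLength σ x = (σ.cycleOf x).support.card := by
  classical
  unfold cycleLength
  congr 1
  ext y
  rw [Equiv.Perm.mem_support_cycleOf_iff]
  simp [hx]

/-- The bridge between cycle counts and positions. For `l ≥ 2` the points are a disjoint union of
supports of cycle factors, for `l = 1` they are the fixed points, and for `l = 0` both sides vanish.
-/
lemma card_cycleLength_eq {N : ℕ} (σ : Equiv.Perm (Fin N)) (l : ℕ) :
    (Finset.univ.filter fun x => cycleLength σ x = l).card = l * cycleCount σ l := by
  classical
  unfold cycleCount
  rw [Equiv.Perm.parts_partition, Multiset.count_add, Multiset.count_replicate, Fintype.card_fin]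
  rcases Nat.lt_or_ge l 2 with hl | hl
  · have h0 : σ.cycleType.count l = 0 := Multiset.count_eq_zero_of_notMem fun h => by
      have := Equiv.Perm.two_le_of_mem_cycleType h
      omega
    interval_cases l
    · simp [(cycleLength_pos σ _).ne']
    · simp only [cycleLength_eq_one_iff, h0, if_true, zero_add, one_mul]
      have := Finset.card_compl σ.support
      rw [Fintype.card_fin] at this
      rw [← this]
      congr 1
      ext x
      simp
  · rw [if_neg (by omega), add_zero, Equiv.Perm.cycleType_def, Multiset.count_map]
    have hU : (Finset.univ.filter fun x => cycleLength σ x = l) =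
        (σ.cycleFactorsFinset.filter fun c => l = c.support.card).biUnion fun c => c.support := by
      ext x
      simp only [Finset.mem_filter, Finset.mem_univ, true_and, Finset.mem_biUnion]
      constructor
      · intro h
        have hx : σ x ≠ x := by
          intro h1
          rw [(cycleLength_eq_one_iff σ x).2 h1] at h
          omega
        refine ⟨σ.cycleOf x, ⟨?_, ?_⟩, ?_⟩
        · rw [Equiv.Perm.cycleOf_mem_cycleFactorsFinset_iff]
          simpa using hx
        · rw [← h, cycleLength_eq_card_support_cycleOf σ hx]
        · rw [Equiv.Perm.mem_support_cycleOf_iff]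
          exact ⟨Equiv.Perm.SameCycle.refl _ _, by simpa using hx⟩
      · rintro ⟨c, ⟨hc, hl'⟩, hx⟩
        have hxs : x ∈ σ.support := Equiv.Perm.mem_cycleFactorsFinset_support_le hc hx
        have : c = σ.cycleOf x := Equiv.Perm.cycle_is_cycleOf hx hc
        rw [cycleLength_eq_card_support_cycleOf σ (by simpa using hxs), ← this, hl']
    rw [hU, Finset.card_biUnion]
    · rw [Finset.sum_congr rfl (g := fun _ => l) fun c hc => (Finset.mem_filter.1 hc).2.symm,
        Finset.sum_const, smul_eq_mul, mul_comm]
      rfl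
    · intro a ha b hb hab
      rw [Function.onFun, ← Equiv.Perm.disjoint_iff_disjoint_support]
      exact Equiv.Perm.cycleFactorsFinset_pairwise_disjoint σ (Finset.mem_filter.1 ha).1
        (Finset.mem_filter.1 hb).1 hab

lemma cycleCount_conj {N : ℕ} (σ τ : Equiv.Perm (Fin N)) (j : ℕ) :
    cycleCount (τ * σ * τ⁻¹) j = cycleCount σ j := by
  unfold cycleCount
  rw [(Equiv.Perm.partition_eq_of_isConj (σ := σ) (τ := τ * σ * τ⁻¹)).1
    (isConj_iff.2 ⟨τ, rfl⟩)]

/-! ### An exponential lower bound for the normalization -/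

/-- A crude Stirling bound `n! e ^ n ≤ e n ^ (n + 1)` with `n = c + 1`; the induction step is `e ≤
(1 + 1 / n) ^ (n + 1)`. -/
lemma factorial_mul_exp_le (c : ℕ) :
    ((c + 1).factorial : ℝ) * Real.exp (c + 1) ≤ Real.exp 1 * ((c : ℝ) + 1) ^ (c + 2) := by
  induction c with
  | zero => simp
  | succ c ih =>
    have hc : (0 : ℝ) < c + 1 := by positivity
    have h1 : Real.exp 1 * ((c : ℝ) + 1) ^ (c + 2) ≤ ((c : ℝ) + 2) ^ (c + 2) := by
      have h2 := Real.one_sub_inv_le_log_of_pos (x := ((c : ℝ) + 2) / (c + 1)) (by positivity)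
      have h3 : (1 : ℝ) ≤ ((c + 2 : ℕ) : ℝ) * Real.log (((c : ℝ) + 2) / (c + 1)) := by
        have : 1 - (((c : ℝ) + 2) / (c + 1))⁻¹ = 1 / (c + 2) := by field_simp; ring
        rw [this] at h2
        push_cast
        calc (1 : ℝ) = (c + 2) * (1 / (c + 2)) := by field_simp
          _ ≤ _ := by gcongr
      have h4 := Real.exp_le_exp.2 h3
      rw [← Real.log_pow, Real.exp_log (by positivity), div_pow, le_div_iff₀ (by positivity)] at h4
      exact h4
    rw [Nat.factorial_succ]
    push_cast
    have h5 : Real.exp ((c : ℝ) + 1 + 1) = Real.exp (c + 1) * Real.exp 1 := Real.exp_add _ _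
    rw [h5]
    calc ((c : ℝ) + 1 + 1) * ((c + 1).factorial : ℝ) * (Real.exp (c + 1) * Real.exp 1)
        = (((c + 1).factorial : ℝ) * Real.exp (c + 1)) * (((c : ℝ) + 2) * Real.exp 1) := by ring
      _ ≤ (Real.exp 1 * ((c : ℝ) + 1) ^ (c + 2)) * (((c : ℝ) + 2) * Real.exp 1) := by gcongr
      _ ≤ ((c : ℝ) + 2) ^ (c + 2) * (((c : ℝ) + 2) * Real.exp 1) := by gcongr
      _ = _ := by ring

/-- The term of index `⌊y⌋` in the series of `exp y` carries the whole sum up to a factor linear in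
`y`. This is why one cycle type is enough on the exponential scale. -/
lemma exp_div_le_pow_floor_div_factorial {y : ℝ} (hy : 0 ≤ y) :
    Real.exp (y - 2) / (y + 1) ≤ y ^ ⌊y⌋₊ / (⌊y⌋₊.factorial : ℝ) := by
  rcases h : ⌊y⌋₊ with _ | c
  · have h1 : y < 1 := Nat.floor_eq_zero.1 h
    have : Real.exp (y - 2) ≤ 1 := Real.exp_le_one_iff.2 (by linarith)
    simp only [pow_zero, Nat.factorial_zero, Nat.cast_one, div_one]
    rw [div_le_one (by positivity)]
    linarith
  · have h1 : ((c + 1 : ℕ) : ℝ) ≤ y := h ▸ Nat.floor_le hy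
    have h2 : y < ((c + 1 : ℕ) : ℝ) + 1 := h ▸ Nat.lt_floor_add_one y
    push_cast at h1 h2
    rw [div_le_div_iff₀ (by positivity) (by positivity)]
    have h3 := factorial_mul_exp_le c
    have h4 : Real.exp (y - 2) ≤ Real.exp c := Real.exp_le_exp.2 (by linarith)
    have h5 : Real.exp ((c : ℝ) + 1) = Real.exp c * Real.exp 1 := Real.exp_add _ _
    rw [h5] at h3
    have h6 : ((c + 1).factorial : ℝ) * Real.exp c ≤ ((c : ℝ) + 1) ^ (c + 2) := by
      have := Real.exp_pos 1
      nlinarith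
    calc Real.exp (y - 2) * ((c + 1).factorial : ℝ) ≤ Real.exp c * ((c + 1).factorial : ℝ) := by gcongr
      _ ≤ ((c : ℝ) + 1) ^ (c + 2) := by rw [mul_comm]; exact h6
      _ = ((c : ℝ) + 1) ^ (c + 1) * (c + 1) := by ring
      _ ≤ y ^ (c + 1) * (y + 1) := by
        gcongr
        linarith

/-- The lengths with `κ_j > 0` have greatest common divisor one, so the numerical semigroup that
they generate contains every large integer. -/
lemma exists_cycle_type_of_ge {κ : ℕ → ℝ} (hκ : ∀ j : ℕ, 1 ≤ j → 0 ≤ κ j) (hna : NonArithmetic κ) :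
    ∃ K : ℕ, ∀ s ≥ K, ∃ e : ℕ → ℕ, (∀ j, e j ≠ 0 → 1 ≤ j ∧ j ≤ s ∧ 0 < κ j) ∧
      ∑ j ∈ Finset.Icc 1 s, j * e j = s := by
  set S : Set ℕ := {j | 1 ≤ j ∧ 0 < κ j} with hS
  have hgcd : Nat.setGcd S = 1 := by
    by_contra h
    have hdvd : ∀ d : ℕ, 1 < d → ¬ ∀ j : ℕ, 1 ≤ j → κ j ≠ 0 → d ∣ j := fun d hd hall =>
      hna ⟨d, hd, hall⟩
    have hS' : ∀ j : ℕ, 1 ≤ j → κ j ≠ 0 → j ∈ S := fun j hj h0 => ⟨hj, lt_of_le_of_ne (hκ j hj) h0.symm⟩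
    rcases Nat.eq_zero_or_pos (Nat.setGcd S) with h0 | h0
    -- A vanishing gcd means that no length is available; then every divisor works vacuously, for
    -- instance `2`.
    · refine hdvd 2 (by norm_num) fun j hj hk => ?_
      have := Nat.setGcd_dvd_of_mem (hS' j hj hk)
      rw [h0, zero_dvd_iff] at this
      omega
    · exact hdvd (Nat.setGcd S) (by omega) fun j hj hk => Nat.setGcd_dvd_of_mem (hS' j hj hk)
  obtain ⟨K, hK⟩ := Nat.exists_mem_closure_of_ge S
  refine ⟨K, fun s hs => ?_⟩
  have hmem := hK s hs (by rw [hgcd]; exact one_dvd _)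
  have key : ∃ e : ℕ →₀ ℕ, (∀ j, e j ≠ 0 → j ∈ S) ∧ e.sum (fun j n => j * n) = s := by
    refine AddSubmonoid.closure_induction (motive := fun s _ => ∃ e : ℕ →₀ ℕ,
      (∀ j, e j ≠ 0 → j ∈ S) ∧ e.sum (fun j n => j * n) = s) ?_ ?_ ?_ hmem
    · intro j hj
      refine ⟨Finsupp.single j 1, fun i hi => ?_, by simp⟩
      rw [Finsupp.single_apply] at hi
      split_ifs at hi with h
      · exact h ▸ hj
      · exact absurd rfl hi
    · exact ⟨0, by simp, by simp⟩
    · rintro a b - - ⟨e, he, hea⟩ ⟨f, hf, hfb⟩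
      refine ⟨e + f, fun j hj => ?_, ?_⟩
      · rcases Nat.eq_zero_or_pos (e j) with h | h
        · exact hf j fun h' => hj (by simp [h, h'])
        · exact he j h.ne'
      · rw [Finsupp.sum_add_index' (by simp) (by intros; ring), hea, hfb]
  obtain ⟨e, he, hes⟩ := key
  have hle : ∀ j, e j ≠ 0 → j ≤ s := by
    intro j hj
    have h1 : j * e j ≤ s := by
      rw [← hes, Finsupp.sum]
      exact Finset.single_le_sum (f := fun j => j * e j) (fun _ _ => Nat.zero_le _)
        (Finsupp.mem_support_iff.2 hj)
    exact (Nat.le_mul_of_pos_right j (Nat.pos_of_ne_zero hj)).trans h1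
  refine ⟨e, fun j hj => ⟨(he j hj).1, hle j hj, (he j hj).2⟩, ?_⟩
  conv_rhs => rw [← hes]
  rw [Finsupp.sum]
  symm
  refine Finset.sum_subset ?_ ?_
  · intro j hj
    rw [Finsupp.mem_support_iff] at hj
    exact Finset.mem_Icc.2 ⟨(he j hj).1, hle j hj⟩
  · intro j _ hj
    rw [Finsupp.notMem_support_iff] at hj
    simp [hj]

lemma factorial_add_le (f e : ℕ) : (f + e).factorial ≤ f.factorial * (f + e) ^ e := by
  rw [← Nat.factorial_mul_ascFactorial]
  gcongr
  exact Nat.ascFactorial_le_pow_add f e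

/-- Adding `e` cycles of length `j` to `f` existing ones changes the term by at least the factor `k
^ e`, free of `N`: each new factor in the factorial is at most `f + e ≤ N / j`, and the weight `w /
j ≥ N k / j` compensates for it. -/
lemma poissonTerm_add_ge {N j f e : ℕ} {k w M : ℝ} (hj : 1 ≤ j) (hk : 0 ≤ k) (hM : 0 ≤ M)
    (hMN : M ≤ N) (hw : N * k ≤ w) (hfe : j * (f + e) ≤ N) :
    (M * k / j) ^ f / f.factorial * k ^ e ≤ (w / j) ^ (f + e) / (f + e).factorial := by
  have hj0 : (0 : ℝ) < j := by exact_mod_cast hj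
  have h1 : M * k / j ≤ w / j := by
    gcongr
    exact (mul_le_mul_of_nonneg_right hMN hk).trans hw
  have h0 : 0 ≤ M * k / j := by positivity
  have hw0 : 0 ≤ w / j := h0.trans h1
  have h2 : ((f + e : ℕ) : ℝ) * k ≤ w / j := by
    rw [le_div_iff₀ hj0]
    refine le_trans ?_ hw
    have : ((j * (f + e) : ℕ) : ℝ) ≤ N := by exact_mod_cast hfe
    push_cast at this ⊢
    nlinarith
  have h3 : ((f + e).factorial : ℝ) ≤ f.factorial * ((f + e : ℕ) : ℝ) ^ e := by
    exact_mod_cast factorial_add_le f e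
  rw [div_mul_eq_mul_div, div_le_div_iff₀ (by positivity) (by positivity), pow_add]
  calc (M * k / j) ^ f * k ^ e * ((f + e).factorial : ℝ)
      ≤ (w / j) ^ f * k ^ e * (f.factorial * ((f + e : ℕ) : ℝ) ^ e) := by gcongr
    _ = (w / j) ^ f * (((f + e : ℕ) : ℝ) * k) ^ e * f.factorial := by rw [mul_pow]; ring
    _ ≤ (w / j) ^ f * (w / j) ^ e * f.factorial := by gcongr

/-- If `∑_{j ≤ J} κ_j x^j = 1`, the normalization is at least of the exponential order
`(e^{g(x)} / x)^N`, where `g` is the truncation of `g_κ` at `J`. -/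
lemma exists_le_normConst {θ κ : ℕ → ℝ} (hθ : ∀ j : ℕ, 1 ≤ j → 0 ≤ θ j)
    (hκ : ∀ j : ℕ, 1 ≤ j → 0 ≤ κ j) (hna : NonArithmetic κ) {x : ℝ} (hx : 0 < x) (J : ℕ)
    (h1 : ∑ j ∈ Finset.Icc 1 J, κ j * x ^ j = 1) :
    ∃ δ > 0, ∀ᶠ N : ℕ in atTop,
      δ * Real.exp (N * (∑ j ∈ Finset.Icc 1 J, κ j * x ^ j / j - Real.log x)) / ((N : ℝ) + 1) ^ J ≤
        normConst θ κ N := by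
  obtain ⟨K, hK⟩ := exists_cycle_type_of_ge hκ hna
  choose! e he hes using hK
  set q : ℕ → ℝ := fun j => κ j * x ^ j / j with hq
  have hq0 : ∀ j, 1 ≤ j → 0 ≤ q j := fun j hj => by
    have := hκ j hj
    positivity
  have hjq : ∀ j, 1 ≤ j → j * q j = κ j * x ^ j := fun j hj => by
    have : (j : ℝ) ≠ 0 := by positivity
    simp only [hq]
    field_simp
  have hq1 : ∀ j ∈ Finset.Icc 1 J, q j ≤ 1 := fun j hj => by
    have hj1 := (Finset.mem_Icc.1 hj).1
    have h2 := Finset.single_le_sum (f := fun j => κ j * x ^ j) (fun i hi => by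
      have := hκ i (Finset.mem_Icc.1 hi).1
      positivity) hj
    rw [h1] at h2
    have h3 : (1 : ℝ) ≤ j := by exact_mod_cast hj1
    have h4 := hq0 j hj1
    have h5 := hjq j hj1
    nlinarith
  set G := ∑ j ∈ Finset.Icc 1 J, q j with hG
  have hG0 : 0 ≤ G := Finset.sum_nonneg fun j hj => hq0 j (Finset.mem_Icc.1 hj).1
  -- The remainder `s` left after rounding will lie in this finite range, so the cost of filling it
  -- is bounded below uniformly in `N`.
  obtain ⟨δ₀, hδ₀, hδ⟩ : ∃ δ₀ > 0, ∀ s ∈ Finset.Icc K (K + J * J),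
      δ₀ ≤ ∏ j ∈ Finset.Icc 1 s, κ j ^ e s j := by
    obtain ⟨s, hs, hmin⟩ := Finset.exists_min_image (Finset.Icc K (K + J * J))
      (fun s => ∏ j ∈ Finset.Icc 1 s, κ j ^ e s j) ⟨K, by simp⟩
    refine ⟨_, Finset.prod_pos fun j hj => ?_, hmin⟩
    by_cases h : e s j = 0
    · simp [h]
    · exact pow_pos (he s (Finset.mem_Icc.1 hs).1 j h).2.2 _
  set B : ℕ := K + J * J with hB
  refine ⟨δ₀ * Real.exp (-(B * |Real.log x|)) * Real.exp (-(K * G) - 2 * J), by positivity, ?_⟩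
  filter_upwards [eventually_ge_atTop (B + J)] with N hN
  -- the numbers of cycles
  set M : ℝ := ((N - K : ℕ) : ℝ) with hM
  have hKN : K ≤ N := by omega
  have hM' : M = N - K := by rw [hM, Nat.cast_sub hKN]
  have hM0 : 0 ≤ M := by positivity
  set f : ℕ → ℕ := fun j => if j ∈ Finset.Icc 1 J then ⌊M * q j⌋₊ else 0 with hf
  have hfJ : ∀ j ∈ Finset.Icc 1 J, f j = ⌊M * q j⌋₊ := fun j hj => if_pos hj
  set n := ∑ j ∈ Finset.Icc 1 J, j * f j with hn
  have hn1 : n ≤ N - K := by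
    have : (n : ℝ) ≤ M := by
      rw [hn]
      push_cast
      calc ∑ j ∈ Finset.Icc 1 J, (j : ℝ) * (f j : ℝ)
          ≤ ∑ j ∈ Finset.Icc 1 J, M * (κ j * x ^ j) := by
            refine Finset.sum_le_sum fun j hj => ?_
            have hj1 := (Finset.mem_Icc.1 hj).1
            rw [hfJ j hj, ← hjq j hj1]
            have := Nat.floor_le (mul_nonneg hM0 (hq0 j hj1))
            calc (j : ℝ) * ⌊M * q j⌋₊ ≤ j * (M * q j) := by gcongr
              _ = _ := by ring
        _ = M := by rw [← Finset.mul_sum, h1, mul_one]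
    rw [hM] at this
    exact_mod_cast this
  -- Rounding down loses at most `j ≤ J` elements for each of the `J` lengths.
  have hn2 : N - K ≤ n + J * J := by
    have : M ≤ n + J * J := by
      rw [hn]
      push_cast
      calc M = ∑ j ∈ Finset.Icc 1 J, M * (κ j * x ^ j) := by rw [← Finset.mul_sum, h1, mul_one]
        _ ≤ ∑ j ∈ Finset.Icc 1 J, ((j : ℝ) * (f j : ℝ) + J) := by
            refine Finset.sum_le_sum fun j hj => ?_
            have hj1 := (Finset.mem_Icc.1 hj).1
            have hjJ : (j : ℝ) ≤ J := by exact_mod_cast (Finset.mem_Icc.1 hj).2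
            rw [hfJ j hj, ← hjq j hj1]
            have := (Nat.lt_floor_add_one (M * q j)).le
            calc M * (j * q j) = j * (M * q j) := by ring
              _ ≤ j * (⌊M * q j⌋₊ + 1) := by gcongr
              _ ≤ _ := by rw [mul_add, mul_one]; gcongr
        _ = _ := by rw [Finset.sum_add_distrib]; simp
    rw [hM] at this
    exact_mod_cast this
  set s := N - n with hs
  have hsK : s ∈ Finset.Icc K B := Finset.mem_Icc.2 ⟨by omega, by omega⟩
  have hsK' : K ≤ s := (Finset.mem_Icc.1 hsK).1
  have hJN : Finset.Icc 1 J ⊆ Finset.Icc 1 N := Finset.Icc_subset_Icc_right (by omega)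
  have hsN : Finset.Icc 1 s ⊆ Finset.Icc 1 N := Finset.Icc_subset_Icc_right (by omega)
  have hsum : ∑ j ∈ Finset.Icc 1 N, j * (f j + e s j) = N := by
    simp only [mul_add, Finset.sum_add_distrib]
    have hA : ∑ j ∈ Finset.Icc 1 N, j * f j = n := by
      rw [hn]
      symm
      refine Finset.sum_subset hJN fun j _ hj => ?_
      simp only [hf, if_neg hj, mul_zero]
    have hE : ∑ j ∈ Finset.Icc 1 N, j * e s j = s := by
      conv_rhs => rw [← hes s hsK']
      symm
      refine Finset.sum_subset hsN fun j hj hj' => ?_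
      by_cases h0 : e s j = 0
      · simp [h0]
      · have := he s hsK' j h0
        exact absurd (Finset.mem_Icc.2 ⟨this.1, this.2.1⟩) hj'
    rw [hA, hE]
    omega
  rw [normConst_eq_cycleSum]
  refine le_trans ?_ (le_cycleSum _ N (fun j hj => by
    have := hθ j hj; have := hκ j hj; positivity) (fun j => f j + e s j) hsum)
  have hterm : ∏ j ∈ Finset.Icc 1 N, ((M * κ j / j) ^ f j / (f j).factorial * κ j ^ e s j) ≤
      ∏ j ∈ Finset.Icc 1 N, ((θ j + N * κ j) / j) ^ (f j + e s j) / ((f j + e s j).factorial : ℝ) := by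
    refine Finset.prod_le_prod (fun j hj => ?_) fun j hj => ?_
    · have := hκ j (Finset.mem_Icc.1 hj).1
      positivity
    · have hj1 := (Finset.mem_Icc.1 hj).1
      refine poissonTerm_add_ge (N := N) hj1 (hκ j hj1) hM0 (by rw [hM']; linarith [Nat.cast_nonneg (α := ℝ) K])
        (by linarith [hθ j hj1]) ?_
      have := Finset.single_le_sum (f := fun j => j * (f j + e s j)) (fun _ _ => Nat.zero_le _) hj
      rwa [hsum] at this
  refine le_trans ?_ hterm
  rw [Finset.prod_mul_distrib]
  have hE : ∏ j ∈ Finset.Icc 1 N, κ j ^ e s j = ∏ j ∈ Finset.Icc 1 s, κ j ^ e s j := by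
    symm
    refine Finset.prod_subset hsN fun j hj hj' => ?_
    by_cases h0 : e s j = 0
    · simp [h0]
    · have := he s hsK' j h0
      exact absurd (Finset.mem_Icc.2 ⟨this.1, this.2.1⟩) hj'
  have hF : ∏ j ∈ Finset.Icc 1 N, (M * κ j / j) ^ f j / ((f j).factorial : ℝ) =
      ∏ j ∈ Finset.Icc 1 J, (M * κ j / j) ^ f j / ((f j).factorial : ℝ) := by
    symm
    refine Finset.prod_subset hJN fun j _ hj => ?_
    have : f j = 0 := if_neg hj
    simp [this]
  rw [hE, hF]
  -- Since `κ_j / j = q_j / x ^ j`, extracting the powers of `x` leaves the largest Poisson terms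
  -- with parameters `M q_j`.
  have hF2 : (x ^ n)⁻¹ * (Real.exp (M * G - 2 * J) / ((N : ℝ) + 1) ^ J) ≤
      ∏ j ∈ Finset.Icc 1 J, (M * κ j / j) ^ f j / ((f j).factorial : ℝ) := by
    have e1 : (x ^ n)⁻¹ = ∏ j ∈ Finset.Icc 1 J, (x ^ (j * f j))⁻¹ := by
      rw [Finset.prod_inv_distrib, Finset.prod_pow_eq_pow_sum]
    have e2 : Real.exp (M * G - 2 * J) = ∏ j ∈ Finset.Icc 1 J, Real.exp (M * q j - 2) := by
      rw [← Real.exp_sum, Finset.sum_sub_distrib, ← Finset.mul_sum]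
      simp [hG, mul_comm]
    have e3 : ((N : ℝ) + 1) ^ J = ∏ j ∈ Finset.Icc 1 J, ((N : ℝ) + 1) := by simp
    rw [e1, e2, e3, ← Finset.prod_div_distrib, ← Finset.prod_mul_distrib]
    refine Finset.prod_le_prod (fun j _ => by positivity) fun j hj => ?_
    have hj1 := (Finset.mem_Icc.1 hj).1
    have hMq : 0 ≤ M * q j := mul_nonneg hM0 (hq0 j hj1)
    have h3 := exp_div_le_pow_floor_div_factorial hMq
    rw [← hfJ j hj] at h3
    have h4 : (M * κ j / j) ^ f j = (x ^ (j * f j))⁻¹ * (M * q j) ^ f j := by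
      have hxj : x ^ j ≠ 0 := by positivity
      rw [pow_mul, ← inv_pow, ← mul_pow]
      congr 1
      simp only [hq]
      field_simp
    rw [h4, mul_div_assoc]
    refine mul_le_mul_of_nonneg_left (le_trans ?_ h3) (by positivity)
    gcongr
    have := hq1 j hj
    have hMN : M ≤ N := by rw [hM']; linarith [Nat.cast_nonneg (α := ℝ) K]
    nlinarith
  -- Replacing `x ^ n` by `x ^ N` costs a bounded factor, because `0 ≤ N - n ≤ B`; the absolute
  -- value covers both signs of `log x`.
  have hxn : Real.exp (-(N * Real.log x)) * Real.exp (-(B * |Real.log x|)) ≤ (x ^ n)⁻¹ := by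
    have : (x ^ n)⁻¹ = Real.exp (-(n * Real.log x)) := by
      rw [Real.exp_neg, ← Real.log_pow, Real.exp_log (by positivity)]
    rw [this, ← Real.exp_add]
    refine Real.exp_le_exp.2 ?_
    have hNn : (N : ℝ) - n ≤ B := by
      have : N ≤ B + n := by omega
      have : (N : ℝ) ≤ B + n := by exact_mod_cast this
      linarith
    have hNn0 : (0 : ℝ) ≤ N - n := by
      have : n ≤ N := by omega
      have : (n : ℝ) ≤ N := by exact_mod_cast this
      linarith
    have := neg_abs_le (Real.log x)
    nlinarith [abs_nonneg (Real.log x)]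
  have hprod := hδ s hsK
  calc _ = (Real.exp (-(N * Real.log x)) * Real.exp (-(B * |Real.log x|))) *
        (Real.exp (M * G - 2 * J) / ((N : ℝ) + 1) ^ J) * δ₀ := by
        have : Real.exp (N * (G - Real.log x)) * Real.exp (-(K * G) - 2 * J) =
            Real.exp (-(N * Real.log x)) * Real.exp (M * G - 2 * J) := by
          rw [← Real.exp_add, ← Real.exp_add, hM']
          congr 1
          ring
        rw [mul_div_assoc', div_mul_eq_mul_div]
        congr 1
        linear_combination δ₀ * Real.exp (-(B * |Real.log x|)) * this
    _ ≤ (x ^ n)⁻¹ * (Real.exp (M * G - 2 * J) / ((N : ℝ) + 1) ^ J) * δ₀ := by gcongr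
    _ ≤ _ := by
      gcongr
      exact le_trans (by positivity) hF2

/-- The conditions on `r` that determine the exponential growth of the normalization. -/
structure IsCriticalRadius (θ κ : ℕ → ℝ) (r : ℝ) : Prop where
  pos : 0 < r
  sum_le : ∀ J, ∑ j ∈ Finset.Icc 1 J, κ j * r ^ j ≤ 1
  lt_sum : ∀ y, r < y → ∃ J, 1 < ∑ j ∈ Finset.Icc 1 J, κ j * y ^ j
  bdd : ∀ x, 0 < x → x < r → ∃ T, ∀ J, ∑ j ∈ Finset.Icc 1 J, θ j * x ^ j / j ≤ T

/-- The partial sums of `κ_j r ^ j` may stay below one, so `r` is moved up to an `x ≤ r e ^ (ε / 2)`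
at which a long partial sum equals one. This costs `ε / 2` in `log x`; the other `ε / 2` absorbs the
polynomial factor. -/
lemma eventually_le_normConst {θ κ : ℕ → ℝ} (hθ : ∀ j : ℕ, 1 ≤ j → 0 ≤ θ j)
    (hκ : ∀ j : ℕ, 1 ≤ j → 0 ≤ κ j) (hna : NonArithmetic κ) {r : ℝ} (hr : IsCriticalRadius θ κ r)
    (J₀ : ℕ) {ε : ℝ} (hε : 0 < ε) :
    ∀ᶠ N : ℕ in atTop, Real.exp (N * (∑ j ∈ Finset.Icc 1 J₀, κ j * r ^ j / j - Real.log r - ε)) ≤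
      normConst θ κ N := by
  have hr0 := hr.pos
  have hy : r < r * Real.exp (ε / 2) := by
    have := Real.add_one_lt_exp (x := ε / 2) (by positivity)
    nlinarith
  obtain ⟨J₁, hJ₁⟩ := hr.lt_sum _ hy
  set J := max J₀ J₁
  have hJ : 1 < ∑ j ∈ Finset.Icc 1 J, κ j * (r * Real.exp (ε / 2)) ^ j := by
    refine hJ₁.trans_le (Finset.sum_le_sum_of_subset_of_nonneg
      (Finset.Icc_subset_Icc_right (le_max_right _ _)) fun j hj _ => ?_)
    have := hκ j (Finset.mem_Icc.1 hj).1
    positivity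
  obtain ⟨x, hx, hx1⟩ : ∃ x ∈ Set.Icc r (r * Real.exp (ε / 2)),
      ∑ j ∈ Finset.Icc 1 J, κ j * x ^ j = 1 := by
    have hc : Continuous fun x : ℝ => ∑ j ∈ Finset.Icc 1 J, κ j * x ^ j := by fun_prop
    exact intermediate_value_Icc hy.le hc.continuousOn ⟨hr.sum_le J, hJ.le⟩
  have hx0 : 0 < x := hr0.trans_le hx.1
  obtain ⟨δ, hδ, hev⟩ := exists_le_normConst hθ hκ hna hx0 J hx1
  have hlim : ∀ᶠ N : ℕ in atTop, ((N : ℝ) + 1) ^ J * δ⁻¹ ≤ Real.exp (N * (ε / 2)) := by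
    have h1 : (fun N : ℕ => ((N : ℝ) + 1) ^ J) =o[atTop] fun N : ℕ => Real.exp (ε / 2 * ((N : ℝ) + 1)) := by
      have := (isLittleO_pow_exp_pos_mul_atTop J (b := ε / 2) (by positivity)).comp_tendsto
        (tendsto_atTop_add_const_right atTop (1 : ℝ) (tendsto_natCast_atTop_atTop (R := ℝ)))
      exact this
    have h2 := h1.bound (c := δ * Real.exp (-(ε / 2))) (by positivity)
    filter_upwards [h2] with N hN
    rw [Real.norm_of_nonneg (by positivity), Real.norm_of_nonneg (by positivity), mul_assoc,
      ← Real.exp_add] at hN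
    rw [← div_eq_mul_inv, div_le_iff₀ hδ, mul_comm (Real.exp _)]
    calc _ ≤ _ := hN
      _ = _ := by congr 2; ring
  filter_upwards [hev, hlim] with N hN hN2
  refine le_trans ?_ hN
  have hG : ∑ j ∈ Finset.Icc 1 J₀, κ j * r ^ j / j ≤ ∑ j ∈ Finset.Icc 1 J, κ j * x ^ j / j := by
    calc ∑ j ∈ Finset.Icc 1 J₀, κ j * r ^ j / j ≤ ∑ j ∈ Finset.Icc 1 J, κ j * r ^ j / j := by
          refine Finset.sum_le_sum_of_subset_of_nonneg
            (Finset.Icc_subset_Icc_right (le_max_left _ _)) fun j hj _ => ?_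
          have := hκ j (Finset.mem_Icc.1 hj).1
          positivity
      _ ≤ _ := by
          refine Finset.sum_le_sum fun j hj => ?_
          have := hκ j (Finset.mem_Icc.1 hj).1
          have := hx.1
          gcongr
  have hlog : Real.log x ≤ Real.log r + ε / 2 := by
    rw [← Real.log_exp (ε / 2), ← Real.log_mul hr0.ne' (Real.exp_pos _).ne']
    exact Real.log_le_log hx0 hx.2
  have h3 : Real.exp (N * (∑ j ∈ Finset.Icc 1 J₀, κ j * r ^ j / j - Real.log r - ε)) *
      Real.exp (N * (ε / 2)) ≤
      Real.exp (N * (∑ j ∈ Finset.Icc 1 J, κ j * x ^ j / j - Real.log x)) := by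
    rw [← Real.exp_add, ← mul_add]
    refine Real.exp_le_exp.2 (mul_le_mul_of_nonneg_left (by linarith) (Nat.cast_nonneg N))
  rw [le_div_iff₀ (by positivity)]
  rw [← div_eq_mul_inv, div_le_iff₀ hδ] at hN2
  calc _ ≤ Real.exp (N * (∑ j ∈ Finset.Icc 1 J₀, κ j * r ^ j / j - Real.log r - ε)) *
        (Real.exp (N * (ε / 2)) * δ) := by gcongr
    _ = δ * (Real.exp (N * (∑ j ∈ Finset.Icc 1 J₀, κ j * r ^ j / j - Real.log r - ε)) *
        Real.exp (N * (ε / 2))) := by ring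
    _ ≤ _ := by gcongr

/-! ### Concentration of the cycle counts -/

/-- The expectation of `f` under the surrogate-spatial measure. -/
def mean (θ κ : ℕ → ℝ) (N : ℕ) (f : Equiv.Perm (Fin N) → ℝ) : ℝ :=
  ∑ σ : Equiv.Perm (Fin N), permMass θ κ N σ * f σ

lemma cycleWeight_nonneg {θ κ : ℕ → ℝ} (hθ : ∀ j : ℕ, 1 ≤ j → 0 ≤ θ j)
    (hκ : ∀ j : ℕ, 1 ≤ j → 0 ≤ κ j) (N : ℕ) (σ : Equiv.Perm (Fin N)) :
    0 ≤ cycleWeight θ κ N σ := by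
  refine Finset.prod_nonneg fun j hj => ?_
  have := hθ j (Finset.mem_Icc.1 hj).1
  have := hκ j (Finset.mem_Icc.1 hj).1
  positivity

lemma normConst_nonneg {θ κ : ℕ → ℝ} (hθ : ∀ j : ℕ, 1 ≤ j → 0 ≤ θ j)
    (hκ : ∀ j : ℕ, 1 ≤ j → 0 ≤ κ j) (N : ℕ) : 0 ≤ normConst θ κ N :=
  mul_nonneg (by positivity) (Finset.sum_nonneg fun σ _ => cycleWeight_nonneg hθ hκ N σ)

lemma permMass_nonneg {θ κ : ℕ → ℝ} (hθ : ∀ j : ℕ, 1 ≤ j → 0 ≤ θ j)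
    (hκ : ∀ j : ℕ, 1 ≤ j → 0 ≤ κ j) (N : ℕ) (σ : Equiv.Perm (Fin N)) :
    0 ≤ permMass θ κ N σ :=
  div_nonneg (cycleWeight_nonneg hθ hκ N σ)
    (mul_nonneg (by positivity) (normConst_nonneg hθ hκ N))

lemma sum_permMass {θ κ : ℕ → ℝ} {N : ℕ} (h : 0 < normConst θ κ N) :
    ∑ σ : Equiv.Perm (Fin N), permMass θ κ N σ = 1 := by
  unfold permMass
  rw [← Finset.sum_div]
  have h1 : ∑ σ : Equiv.Perm (Fin N), cycleWeight θ κ N σ = (N.factorial : ℝ) * normConst θ κ N := by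
    unfold normConst
    have : (N.factorial : ℝ) ≠ 0 := by positivity
    field_simp
  rw [h1]
  exact div_self (by positivity)

lemma mean_mono {θ κ : ℕ → ℝ} (hθ : ∀ j : ℕ, 1 ≤ j → 0 ≤ θ j)
    (hκ : ∀ j : ℕ, 1 ≤ j → 0 ≤ κ j) (N : ℕ) {f g : Equiv.Perm (Fin N) → ℝ} (h : ∀ σ, f σ ≤ g σ) :
    mean θ κ N f ≤ mean θ κ N g :=
  Finset.sum_le_sum fun σ _ => mul_le_mul_of_nonneg_left (h σ) (permMass_nonneg hθ hκ N σ)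

lemma mean_add (θ κ : ℕ → ℝ) (N : ℕ) (f g : Equiv.Perm (Fin N) → ℝ) :
    mean θ κ N (fun σ => f σ + g σ) = mean θ κ N f + mean θ κ N g := by
  simp only [mean, mul_add, Finset.sum_add_distrib]

lemma mean_sub (θ κ : ℕ → ℝ) (N : ℕ) (f g : Equiv.Perm (Fin N) → ℝ) :
    mean θ κ N (fun σ => f σ - g σ) = mean θ κ N f - mean θ κ N g := by
  simp only [mean, mul_sub, Finset.sum_sub_distrib]

lemma mean_const_mul (θ κ : ℕ → ℝ) (N : ℕ) (c : ℝ) (f : Equiv.Perm (Fin N) → ℝ) :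
    mean θ κ N (fun σ => c * f σ) = c * mean θ κ N f := by
  simp only [mean, Finset.mul_sum]
  exact Finset.sum_congr rfl fun σ _ => by ring

lemma mean_sum (θ κ : ℕ → ℝ) (N : ℕ) {ι : Type*} (s : Finset ι) (f : ι → Equiv.Perm (Fin N) → ℝ) :
    mean θ κ N (fun σ => ∑ i ∈ s, f i σ) = ∑ i ∈ s, mean θ κ N (f i) := by
  simp only [mean, Finset.mul_sum]
  exact Finset.sum_comm

lemma mean_const {θ κ : ℕ → ℝ} {N : ℕ} (h : 0 < normConst θ κ N) (c : ℝ) :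
    mean θ κ N (fun _ => c) = c := by
  simp only [mean]
  rw [← Finset.sum_mul, sum_permMass h, one_mul]

/-- Exponential tilting stays within the class of cycle-weighted measures: only the weight of length
`l` changes, by the factor `exp s`. -/
lemma mean_exp_cycleCount (θ κ : ℕ → ℝ) {N l : ℕ} (hl : l ∈ Finset.Icc 1 N) (s : ℝ) :
    mean θ κ N (fun σ => Real.exp (s * cycleCount σ l)) =
      cycleSum (fun j => (θ j + N * κ j) * if j = l then Real.exp s else 1) N / normConst θ κ N := by
  unfold mean permMass cycleSum
  rw [Finset.mul_sum, Finset.sum_div]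
  refine Finset.sum_congr rfl fun σ _ => ?_
  have h1 : ∏ j ∈ Finset.Icc 1 N, ((θ j + N * κ j) * if j = l then Real.exp s else 1) ^ cycleCount σ j =
      cycleWeight θ κ N σ * Real.exp (s * cycleCount σ l) := by
    simp only [mul_pow, Finset.prod_mul_distrib, cycleWeight]
    congr 1
    rw [Finset.prod_eq_single l]
    · rw [if_pos rfl, ← Real.exp_nat_mul, mul_comm]
    · intro j _ hj
      rw [if_neg hj, one_pow]
    · intro h
      exact absurd hl h
  rw [h1]
  field_simp

/-- The asymptotic probability that a given cycle has length `j`. -/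
def limitWeight (κ : ℕ → ℝ) (r : ℝ) (j : ℕ) : ℝ := if j = 0 then 0 else κ j * r ^ j

lemma limitWeight_nonneg {κ : ℕ → ℝ} (hκ : ∀ j : ℕ, 1 ≤ j → 0 ≤ κ j) {r : ℝ} (hr : 0 ≤ r) (j : ℕ) :
    0 ≤ limitWeight κ r j := by
  unfold limitWeight
  split_ifs with h
  · exact le_rfl
  · have := hκ j (Nat.one_le_iff_ne_zero.2 h)
    positivity

section

variable {θ κ : ℕ → ℝ} {r : ℝ}

lemma IsCriticalRadius.exists_sum_gt (hr : IsCriticalRadius θ κ r)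
    (hκ : ∀ j : ℕ, 1 ≤ j → 0 ≤ κ j) {ε : ℝ} (hε : 0 < ε) :
    ∃ (G : ℝ) (J₀ : ℕ), (∀ J, ∑ j ∈ Finset.Icc 1 J, κ j * r ^ j / j ≤ G) ∧
      G - ε ≤ ∑ j ∈ Finset.Icc 1 J₀, κ j * r ^ j / j := by
  have hr0 := hr.pos
  have hb : BddAbove (Set.range fun J => ∑ j ∈ Finset.Icc 1 J, κ j * r ^ j / j) := by
    refine ⟨1, ?_⟩
    rintro _ ⟨J, rfl⟩
    refine le_trans (Finset.sum_le_sum fun j hj => ?_) (hr.sum_le J)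
    have hj1 := (Finset.mem_Icc.1 hj).1
    have := hκ j hj1
    exact div_le_self (by positivity) (by exact_mod_cast hj1)
  obtain ⟨_, ⟨J₀, rfl⟩, h⟩ := exists_lt_of_lt_csSup (Set.range_nonempty _) (sub_lt_self
    (sSup (Set.range fun J => ∑ j ∈ Finset.Icc 1 J, κ j * r ^ j / j)) hε)
  exact ⟨_, J₀, fun J => le_csSup hb ⟨J, rfl⟩, h.le⟩

lemma eventually_normConst_pos (hθ : ∀ j : ℕ, 1 ≤ j → 0 ≤ θ j)
    (hκ : ∀ j : ℕ, 1 ≤ j → 0 ≤ κ j) (hna : NonArithmetic κ) (hr : IsCriticalRadius θ κ r) :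
    ∀ᶠ N : ℕ in atTop, 0 < normConst θ κ N := by
  filter_upwards [eventually_le_normConst hθ hκ hna hr 0 one_pos] with N hN
  exact (Real.exp_pos _).trans_le hN

/-- The coefficient bound for the tilted numerator is divided by the lower bound for the
normalization. The rates `g_κ(r) - log r` cancel up to `ε` and leave the contribution of the tilt.
-/
lemma eventually_mean_exp_cycleCount_le (hθ : ∀ j : ℕ, 1 ≤ j → 0 ≤ θ j)
    (hκ : ∀ j : ℕ, 1 ≤ j → 0 ≤ κ j) (hna : NonArithmetic κ) (hr : IsCriticalRadius θ κ r)
    {l : ℕ} (hl : 1 ≤ l) (s : ℝ) {ε : ℝ} (hε : 0 < ε) :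
    ∀ᶠ N : ℕ in atTop, mean θ κ N (fun σ => Real.exp (s * cycleCount σ l)) ≤
      Real.exp (N * ((Real.exp s - 1) * (κ l * r ^ l / l) + ε)) := by
  have hr0 := hr.pos
  obtain ⟨G, J₀, hG, hJ₀⟩ := hr.exists_sum_gt hκ (ε := ε / 4) (by positivity)
  have hcont : ContinuousAt (fun x : ℝ => (Real.exp s - 1) * (κ l * x ^ l / l) - Real.log x) r := by
    have := Real.continuousAt_log hr0.ne'
    fun_prop
  -- The point `x` lies strictly below `r` because `g_θ` may diverge at `r`. The four quarters of
  -- `ε` pay for this shift, for the contribution of `θ`, for truncating `g_κ`, and for the loss in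
  -- the lower bound.
  obtain ⟨x, hxlt, hxr, hx0⟩ : ∃ x, (Real.exp s - 1) * (κ l * x ^ l / l) - Real.log x <
      (Real.exp s - 1) * (κ l * r ^ l / l) - Real.log r + ε / 4 ∧ x < r ∧ 0 < x := by
    have h1 : ∀ᶠ x in 𝓝[<] r, (Real.exp s - 1) * (κ l * x ^ l / l) - Real.log x <
      (Real.exp s - 1) * (κ l * r ^ l / l) - Real.log r + ε / 4 :=
      (hcont.eventually_lt continuousAt_const (by linarith)).filter_mono nhdsWithin_le_nhds
    have h2 : ∀ᶠ x in 𝓝[<] r, x < r := eventually_mem_nhdsWithin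
    have h3 : ∀ᶠ x in 𝓝[<] r, 0 < x := (lt_mem_nhds hr0).filter_mono nhdsWithin_le_nhds
    exact (h1.and (h2.and h3)).exists
  obtain ⟨T, hT⟩ := hr.bdd x hx0 hxr
  have hTN : ∀ᶠ N : ℕ in atTop, T + (Real.exp s - 1) * (θ l * x ^ l / l) ≤ N * (ε / 4) := by
    have : Tendsto (fun N : ℕ => (N : ℝ) * (ε / 4)) atTop atTop :=
      (tendsto_natCast_atTop_atTop).atTop_mul_const (by positivity)
    exact this.eventually_ge_atTop _
  filter_upwards [hTN, eventually_le_normConst hθ hκ hna hr J₀ (ε := ε / 4) (by positivity),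
    eventually_ge_atTop l] with N hN1 hN2 hN3
  have hlN : l ∈ Finset.Icc 1 N := Finset.mem_Icc.2 ⟨hl, hN3⟩
  have hpos : 0 < normConst θ κ N := (Real.exp_pos _).trans_le hN2
  rw [mean_exp_cycleCount θ κ hlN s, div_le_iff₀ hpos]
  have hup := cycleSum_mul_pow_le (fun j => (θ j + N * κ j) * if j = l then Real.exp s else 1) N
    (fun j hj => by
      have := hθ j hj
      have := hκ j hj
      split_ifs <;> positivity) hx0.le
  have hsum : ∑ j ∈ Finset.Icc 1 N, ((θ j + N * κ j) * if j = l then Real.exp s else 1) * x ^ j / j =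
      ∑ j ∈ Finset.Icc 1 N, θ j * x ^ j / j + N * ∑ j ∈ Finset.Icc 1 N, κ j * x ^ j / j +
        (Real.exp s - 1) * ((θ l + N * κ l) * x ^ l / l) := by
    rw [Finset.mul_sum, ← Finset.sum_add_distrib]
    have : (Real.exp s - 1) * ((θ l + N * κ l) * x ^ l / l) =
        ∑ j ∈ Finset.Icc 1 N, if j = l then (Real.exp s - 1) * ((θ j + N * κ j) * x ^ j / j) else 0 := by
      rw [Finset.sum_ite_eq' (Finset.Icc 1 N) l
        (fun j => (Real.exp s - 1) * ((θ j + N * κ j) * x ^ j / j)), if_pos hlN]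
    rw [this, ← Finset.sum_add_distrib]
    refine Finset.sum_congr rfl fun j _ => ?_
    split_ifs <;> ring
  have hκx : ∑ j ∈ Finset.Icc 1 N, κ j * x ^ j / j ≤ G := by
    refine le_trans (Finset.sum_le_sum fun j hj => ?_) (hG N)
    have := hκ j (Finset.mem_Icc.1 hj).1
    gcongr
  have hxN : x ^ N = Real.exp (N * Real.log x) := by
    rw [← Real.log_pow, Real.exp_log (by positivity)]
  have hNG := mul_le_mul_of_nonneg_left hκx (Nat.cast_nonneg (α := ℝ) N)
  have hNx := mul_le_mul_of_nonneg_left hxlt.le (Nat.cast_nonneg (α := ℝ) N)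
  have hNJ := mul_le_mul_of_nonneg_left hJ₀ (Nat.cast_nonneg (α := ℝ) N)
  rw [hsum, hxN, ← le_div_iff₀ (Real.exp_pos _), ← Real.exp_sub] at hup
  refine hup.trans (le_trans ?_ (mul_le_mul_of_nonneg_left hN2 (Real.exp_pos _).le))
  rw [← Real.exp_add]
  refine Real.exp_le_exp.2 ?_
  have hTT := hT N
  have hexp : (Real.exp s - 1) * ((θ l + N * κ l) * x ^ l / l) =
      (Real.exp s - 1) * (θ l * x ^ l / l) + N * ((Real.exp s - 1) * (κ l * x ^ l / l)) := by ring
  rw [hexp]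
  linarith

lemma mul_cycleCount_le {N : ℕ} (σ : Equiv.Perm (Fin N)) (l : ℕ) : l * cycleCount σ l ≤ N := by
  rw [← card_cycleLength_eq]
  exact (Finset.card_le_univ _).trans (by simp)

lemma mul_cycleCount_div_le_one {N : ℕ} (σ : Equiv.Perm (Fin N)) (l : ℕ) :
    (l * cycleCount σ l : ℝ) / N ≤ 1 :=
  div_le_one_of_le₀ (by exact_mod_cast mul_cycleCount_le σ l) (Nat.cast_nonneg N)

/-- Chernoff bounds on both tails: deviations beyond `η` have exponentially small probability, and
the deviation never exceeds `1 + lam`. -/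
lemma tendsto_mean_abs_cycleCount (hθ : ∀ j : ℕ, 1 ≤ j → 0 ≤ θ j)
    (hκ : ∀ j : ℕ, 1 ≤ j → 0 ≤ κ j) (hna : NonArithmetic κ) (hr : IsCriticalRadius θ κ r)
    {l : ℕ} (hl : 1 ≤ l) :
    Tendsto (fun N : ℕ => mean θ κ N fun σ => |(cycleCount σ l : ℝ) / N - κ l * r ^ l / l|)
      atTop (𝓝 0) := by
  have hr0 := hr.pos
  set lam := κ l * r ^ l / l with hlam
  have hlam0 : 0 ≤ lam := by
    have := hκ l hl
    positivity
  rw [Metric.tendsto_atTop']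
  suffices h : ∀ η > 0, ∀ᶠ N : ℕ in atTop,
      mean θ κ N (fun σ => |(cycleCount σ l : ℝ) / N - lam|) < η by
    intro η hη
    obtain ⟨N₀, hN₀⟩ := eventually_atTop.1 (h η hη)
    refine ⟨N₀, fun N hN => ?_⟩
    rw [Real.dist_eq, sub_zero, abs_of_nonneg]
    · exact hN₀ N hN.le
    · exact Finset.sum_nonneg fun σ _ => mul_nonneg (permMass_nonneg hθ hκ N σ) (abs_nonneg _)
  intro η' hη'
  set η := η' / 2 with hη
  have hη0 : 0 < η := by positivity
  -- With `s ≤ 1` one has `e ^ t - 1 ≤ t + t ^ 2` for `|t| = s`, and `s * lam ≤ η / 4` makes the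
  -- quadratic term at most `s * η / 4`. Together with the error `s * η / 4` of the moment bound,
  -- half of the exponent `s * η` survives.
  set s := min 1 (η / (4 * (lam + 1))) with hs
  have hs0 : 0 < s := lt_min one_pos (by positivity)
  have hs1 : s ≤ 1 := min_le_left _ _
  have hsl : s * lam ≤ η / 4 := by
    have : s ≤ η / (4 * (lam + 1)) := min_le_right _ _
    calc s * lam ≤ η / (4 * (lam + 1)) * (lam + 1) := by gcongr; linarith
      _ = η / 4 := by field_simp
  have hB0 : 0 < 1 + lam := by positivity
  have hmgf : ∀ t : ℝ, |t| = s → (Real.exp t - 1) * lam ≤ t * lam + s * η / 4 := by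
    intro t ht
    have h1 := Real.abs_exp_sub_one_sub_id_le (x := t) (by rw [ht]; exact hs1)
    have h2 : t ^ 2 = s ^ 2 := by rw [← ht, sq_abs]
    have h3 := (abs_le.1 h1).2
    rw [h2] at h3
    nlinarith
  have hev1 := eventually_mean_exp_cycleCount_le hθ hκ hna hr hl s (ε := s * η / 4) (by positivity)
  have hev2 := eventually_mean_exp_cycleCount_le hθ hκ hna hr hl (-s) (ε := s * η / 4) (by positivity)
  have hlim : ∀ᶠ N : ℕ in atTop, 2 * (1 + lam) * Real.exp (-(N * (s * η / 2))) < η := by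
    have h1 : Tendsto (fun N : ℕ => Real.exp (-((N : ℝ) * (s * η / 2)))) atTop (𝓝 0) :=
      Real.tendsto_exp_neg_atTop_nhds_zero.comp
        ((tendsto_natCast_atTop_atTop).atTop_mul_const (by positivity))
    have h2 := h1.const_mul (2 * (1 + lam))
    rw [mul_zero] at h2
    exact h2.eventually_lt_const hη0
  filter_upwards [hev1, hev2, hlim, eventually_normConst_pos hθ hκ hna hr,
    eventually_ge_atTop 1] with N h1 h2 h3 h4 h5
  have hN0 : (0 : ℝ) < N := by exact_mod_cast h5
  have hpt : ∀ σ : Equiv.Perm (Fin N), |(cycleCount σ l : ℝ) / N - lam| ≤ η +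
      ((1 + lam) * Real.exp (-(N * s * (η + lam))) * Real.exp (s * cycleCount σ l) +
        (1 + lam) * Real.exp (-(N * s * (η - lam))) * Real.exp (-s * cycleCount σ l)) := by
    intro σ
    set y := (cycleCount σ l : ℝ) / N - lam with hy
    have hC : (cycleCount σ l : ℝ) = N * (y + lam) := by rw [hy]; field_simp; ring
    have hy1 : |y| ≤ 1 + lam := by
      have h0 : (0 : ℝ) ≤ (cycleCount σ l : ℝ) / N := by positivity
      have h6 : (cycleCount σ l : ℝ) / N ≤ 1 := by
        refine le_trans ?_ (mul_cycleCount_div_le_one σ l)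
        gcongr
        refine le_mul_of_one_le_left (Nat.cast_nonneg _) (by exact_mod_cast hl)
      rw [abs_le]
      constructor <;> linarith
    rw [mul_assoc (1 + lam), mul_assoc (1 + lam), ← Real.exp_add, ← Real.exp_add, hC]
    have e1 : -(N * s * (η + lam)) + s * (N * (y + lam)) = N * s * (y - η) := by ring
    have e2 : -(N * s * (η - lam)) + -s * (N * (y + lam)) = N * s * (-y - η) := by ring
    rw [e1, e2]
    have p1 : 0 ≤ (1 + lam) * Real.exp (N * s * (y - η)) := by positivity
    have p2 : 0 ≤ (1 + lam) * Real.exp (N * s * (-y - η)) := by positivity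
    by_cases hyη : |y| ≤ η
    · linarith
    · push Not at hyη
      rcases lt_abs.1 hyη with h | h
      · have : 1 ≤ Real.exp (N * s * (y - η)) := Real.one_le_exp (by
          have : 0 < y - η := by linarith
          positivity)
        nlinarith
      · have : 1 ≤ Real.exp (N * s * (-y - η)) := Real.one_le_exp (by
          have : 0 < -y - η := by linarith
          positivity)
        nlinarith
  refine (mean_mono hθ hκ N hpt).trans_lt ?_
  rw [mean_add, mean_add, mean_const h4, mean_const_mul, mean_const_mul]
  have b1 : Real.exp (-(N * s * (η + lam))) * mean θ κ N (fun σ => Real.exp (s * cycleCount σ l)) ≤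
      Real.exp (-(N * (s * η / 2))) := by
    refine (mul_le_mul_of_nonneg_left h1 (Real.exp_pos _).le).trans ?_
    rw [← Real.exp_add]
    refine Real.exp_le_exp.2 ?_
    have := hmgf s (abs_of_pos hs0)
    nlinarith
  have b2 : Real.exp (-(N * s * (η - lam))) * mean θ κ N (fun σ => Real.exp (-s * cycleCount σ l)) ≤
      Real.exp (-(N * (s * η / 2))) := by
    refine (mul_le_mul_of_nonneg_left h2 (Real.exp_pos _).le).trans ?_
    rw [← Real.exp_add]
    refine Real.exp_le_exp.2 ?_
    have := hmgf (-s) (by rw [abs_neg, abs_of_pos hs0])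
    nlinarith
  rw [mul_assoc (1 + lam), mul_assoc (1 + lam)]
  have c1 := mul_le_mul_of_nonneg_left b1 hB0.le
  have c2 := mul_le_mul_of_nonneg_left b2 hB0.le
  have : η' = η + η := by rw [hη]; ring
  linarith

/-- Telescoping: the factors are exchanged one at a time, and the remaining ones lie in `[0, 1]`. -/
lemma abs_prod_sub_prod_le {ι : Type*} (s : Finset ι) (a b : ι → ℝ) (ha0 : ∀ i, 0 ≤ a i)
    (ha1 : ∀ i, a i ≤ 1) (hb0 : ∀ i, 0 ≤ b i) (hb1 : ∀ i, b i ≤ 1) :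
    |∏ i ∈ s, a i - ∏ i ∈ s, b i| ≤ ∑ i ∈ s, |a i - b i| := by
  classical
  induction s using Finset.induction_on with
  | empty => simp
  | insert i s hi ih =>
    rw [Finset.prod_insert hi, Finset.prod_insert hi, Finset.sum_insert hi]
    have h1 : a i * ∏ j ∈ s, a j - b i * ∏ j ∈ s, b j =
        (a i - b i) * ∏ j ∈ s, a j + b i * (∏ j ∈ s, a j - ∏ j ∈ s, b j) := by ring
    have h2 : 0 ≤ ∏ j ∈ s, a j := Finset.prod_nonneg fun j _ => ha0 j
    have h3 : ∏ j ∈ s, a j ≤ 1 := Finset.prod_le_one (fun j _ => ha0 j) fun j _ => ha1 j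
    rw [h1]
    refine (abs_add_le _ _).trans ?_
    rw [abs_mul, abs_mul, abs_of_nonneg h2, abs_of_nonneg (hb0 i)]
    refine add_le_add (mul_le_of_le_one_right (abs_nonneg _) h3) ?_
    exact (mul_le_of_le_one_left (abs_nonneg _) (hb1 i)).trans ih

lemma IsCriticalRadius.limitWeight_le_one (hr : IsCriticalRadius θ κ r)
    (hκ : ∀ j : ℕ, 1 ≤ j → 0 ≤ κ j) (l : ℕ) : limitWeight κ r l ≤ 1 := by
  have hr0 := hr.pos
  unfold limitWeight
  split_ifs with h
  · exact zero_le_one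
  · refine le_trans ?_ (hr.sum_le l)
    exact Finset.single_le_sum (f := fun j => κ j * r ^ j) (fun i hi => by
      have := hκ i (Finset.mem_Icc.1 hi).1
      positivity) (Finset.mem_Icc.2 ⟨Nat.one_le_iff_ne_zero.2 h, le_rfl⟩)

/-- The joint moments of the normalized cycle counts converge. -/
lemma tendsto_mean_prod_cycleCount (hθ : ∀ j : ℕ, 1 ≤ j → 0 ≤ θ j)
    (hκ : ∀ j : ℕ, 1 ≤ j → 0 ≤ κ j) (hna : NonArithmetic κ) (hr : IsCriticalRadius θ κ r)
    {m : ℕ} (ℓ : Fin m → ℕ) :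
    Tendsto (fun N : ℕ => mean θ κ N fun σ => ∏ i, ((ℓ i * cycleCount σ (ℓ i) : ℝ) / N))
      atTop (𝓝 (∏ i, limitWeight κ r (ℓ i))) := by
  have hr0 := hr.pos
  rw [tendsto_iff_dist_tendsto_zero]
  have hlim : Tendsto (fun N : ℕ => ∑ i : Fin m, (ℓ i : ℝ) * mean θ κ N fun σ =>
      |(cycleCount σ (ℓ i) : ℝ) / N - κ (ℓ i) * r ^ ℓ i / ℓ i|) atTop (𝓝 0) := by
    rw [← Finset.sum_const_zero (s := (Finset.univ : Finset (Fin m))) (M := ℝ)]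
    refine tendsto_finsetSum _ fun i _ => ?_
    rcases Nat.eq_zero_or_pos (ℓ i) with h | h
    · simp [h]
    · simpa using (tendsto_mean_abs_cycleCount hθ hκ hna hr h).const_mul (ℓ i : ℝ)
  refine squeeze_zero' (Eventually.of_forall fun _ => dist_nonneg) ?_ hlim
  filter_upwards [eventually_normConst_pos hθ hκ hna hr] with N hN
  rw [Real.dist_eq]
  nth_rewrite 1 [← mean_const hN (∏ i, limitWeight κ r (ℓ i))]
  rw [← mean_sub]
  have h1 : |mean θ κ N fun σ => ∏ i, ((ℓ i * cycleCount σ (ℓ i) : ℝ) / N) -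
      ∏ i, limitWeight κ r (ℓ i)| ≤ mean θ κ N fun σ =>
        |∏ i, ((ℓ i * cycleCount σ (ℓ i) : ℝ) / N) - ∏ i, limitWeight κ r (ℓ i)| := by
    unfold mean
    refine (Finset.abs_sum_le_sum_abs _ _).trans (le_of_eq ?_)
    refine Finset.sum_congr rfl fun σ _ => ?_
    rw [abs_mul, abs_of_nonneg (permMass_nonneg hθ hκ N σ)]
  refine h1.trans ?_
  simp only [← mean_const_mul]
  rw [← mean_sum]
  refine mean_mono hθ hκ N fun σ => ?_
  refine (abs_prod_sub_prod_le _ _ _ (fun i => by positivity)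
    (fun i => mul_cycleCount_div_le_one σ _) (fun i => limitWeight_nonneg hκ hr0.le _)
    (fun i => hr.limitWeight_le_one hκ _)).trans (le_of_eq ?_)
  refine Finset.sum_congr rfl fun i _ => ?_
  unfold limitWeight
  split_ifs with h
  · simp [h]
  · have h2 : (0 : ℝ) < ℓ i := by exact_mod_cast Nat.pos_of_ne_zero h
    have h3 : (ℓ i * cycleCount σ (ℓ i) : ℝ) / N - κ (ℓ i) * r ^ ℓ i =
        ℓ i * ((cycleCount σ (ℓ i) : ℝ) / N - κ (ℓ i) * r ^ ℓ i / ℓ i) := by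
      field_simp
    rw [h3, abs_mul, abs_of_pos h2]

end

/-! ### The lexicographically ordered cycle lengths -/

section

variable {N : ℕ} {σ : Equiv.Perm (Fin N)}

lemma mem_remaining_succ_iff {k : ℕ} {x : Fin N} :
    x ∈ remaining σ (k + 1) ↔ ∃ h : (remaining σ k).Nonempty, x ∈ remaining σ k ∧
      ¬ σ.SameCycle ((remaining σ k).min' h) x := by
  rw [remaining]
  split_ifs with h
  · simp [h]
  · simp [h]

lemma lexLength_eq {k : ℕ} (h : (remaining σ k).Nonempty) :
    lexLength σ k = cycleLength σ ((remaining σ k).min' h) := by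
  rw [lexLength, dif_pos h]
  rfl

/-- Each step removes at least the current minimum, so after `k` steps the `k` smallest elements are
gone. -/
lemma le_of_mem_remaining {k : ℕ} {x : Fin N} (hx : x ∈ remaining σ k) : k ≤ (x : ℕ) := by
  induction k generalizing x with
  | zero => exact Nat.zero_le _
  | succ k ih =>
    obtain ⟨h, hxk, hsc⟩ := mem_remaining_succ_iff.1 hx
    by_contra hlt
    have h1 := ih hxk
    have h2 := ih ((remaining σ k).min'_mem h)
    have h3 : (remaining σ k).min' h ≤ x := Finset.min'_le _ _ hxk
    have h4 : (remaining σ k).min' h = x := by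
      apply Fin.ext
      have : ((remaining σ k).min' h : ℕ) ≤ x := h3
      omega
    rw [h4] at hsc
    exact hsc (Equiv.Perm.SameCycle.refl _ _)

lemma exists_lexLength_eq_of_notMem {k : ℕ} {x : Fin N} (hx : x ∉ remaining σ k) :
    ∃ i < k, lexLength σ i = cycleLength σ x := by
  induction k with
  | zero => simp [remaining] at hx
  | succ k ih =>
    by_cases hxk : x ∈ remaining σ k
    · have h : (remaining σ k).Nonempty := ⟨x, hxk⟩
      refine ⟨k, k.lt_succ_self, ?_⟩
      rw [lexLength_eq h]
      refine cycleLength_eq_of_sameCycle ?_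
      by_contra hsc
      exact hx (mem_remaining_succ_iff.2 ⟨h, hxk, hsc⟩)
    · obtain ⟨i, hi, h⟩ := ih hxk
      exact ⟨i, by omega, h⟩

lemma exists_lexLength_eq {m : ℕ} {x : Fin N} (hx : (x : ℕ) < m) :
    ∃ i < m, lexLength σ i = cycleLength σ x :=
  exists_lexLength_eq_of_notMem fun h => by
    have := le_of_mem_remaining h
    omega

/-- When the first `m` elements lie in distinct cycles, element `k` survives the first `k` removals
and is then the minimum, so the lexicographic procedure runs through these elements in turn. -/
lemma mem_remaining_of_distinct {m k : ℕ} (hm : m ≤ N) (hk : k ≤ m)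
    (hD : ∀ i j : Fin m, i ≠ j → ¬ σ.SameCycle (Fin.castLE hm i) (Fin.castLE hm j)) (x : Fin N) :
    x ∈ remaining σ k ↔ ∀ i : Fin m, (i : ℕ) < k → ¬ σ.SameCycle (Fin.castLE hm i) x := by
  induction k generalizing x with
  | zero => simp [remaining]
  | succ k ih =>
    have ih := ih (by omega)
    set i₀ : Fin m := ⟨k, by omega⟩
    have hmem : Fin.castLE hm i₀ ∈ remaining σ k := by
      rw [ih]
      intro i hi
      exact hD i i₀ fun h => by rw [h] at hi; exact lt_irrefl _ hi
    have hne : (remaining σ k).Nonempty := ⟨_, hmem⟩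
    have hmin : (remaining σ k).min' hne = Fin.castLE hm i₀ := by
      refine le_antisymm (Finset.min'_le _ _ hmem) ?_
      exact le_of_mem_remaining ((remaining σ k).min'_mem hne)
    rw [mem_remaining_succ_iff]
    constructor
    · rintro ⟨_, h1, h2⟩ i hi
      rw [hmin] at h2
      rcases Nat.lt_succ_iff_lt_or_eq.1 hi with h | h
      · exact (ih x).1 h1 i h
      · have : i = i₀ := Fin.ext h
        rwa [this]
    · intro h
      refine ⟨hne, (ih x).2 fun i hi => h i (by omega), ?_⟩
      rw [hmin]
      exact h i₀ (Nat.lt_succ_self k)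

lemma lexLength_of_distinct {m : ℕ} (hm : m ≤ N)
    (hD : ∀ i j : Fin m, i ≠ j → ¬ σ.SameCycle (Fin.castLE hm i) (Fin.castLE hm j)) (i : Fin m) :
    lexLength σ i = cycleLength σ (Fin.castLE hm i) := by
  have hmem : Fin.castLE hm i ∈ remaining σ i := by
    rw [mem_remaining_of_distinct hm i.2.le hD]
    exact fun j hj => hD j i fun h => by rw [h] at hj; exact lt_irrefl _ hj
  have hne : (remaining σ i).Nonempty := ⟨_, hmem⟩
  have hmin : (remaining σ i).min' hne = Fin.castLE hm i :=
    le_antisymm (Finset.min'_le _ _ hmem) (le_of_mem_remaining ((remaining σ i).min'_mem hne))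
  rw [lexLength_eq hne, hmin]

end

/-! ### Consequences of conjugation invariance -/

lemma prob_eq_mean (θ κ : ℕ → ℝ) (N : ℕ) (A : Set (Equiv.Perm (Fin N))) :
    prob θ κ N A = mean θ κ N fun σ => A.indicator 1 σ := by
  unfold prob mean
  refine Finset.sum_congr rfl fun σ _ => ?_
  by_cases h : σ ∈ A <;> simp [h]

section

variable {θ κ : ℕ → ℝ}

lemma prob_nonneg (hθ : ∀ j : ℕ, 1 ≤ j → 0 ≤ θ j) (hκ : ∀ j : ℕ, 1 ≤ j → 0 ≤ κ j) (N : ℕ)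
    (A : Set (Equiv.Perm (Fin N))) : 0 ≤ prob θ κ N A := by
  refine Finset.sum_nonneg fun σ _ => ?_
  split_ifs
  · exact permMass_nonneg hθ hκ N σ
  · exact le_rfl

lemma prob_mono (hθ : ∀ j : ℕ, 1 ≤ j → 0 ≤ θ j) (hκ : ∀ j : ℕ, 1 ≤ j → 0 ≤ κ j) (N : ℕ)
    {A B : Set (Equiv.Perm (Fin N))} (h : A ⊆ B) : prob θ κ N A ≤ prob θ κ N B := by
  classical
  rw [prob_eq_mean, prob_eq_mean]
  exact mean_mono hθ hκ N fun σ =>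
    Set.indicator_le_indicator_of_subset h (fun _ => zero_le_one) σ

lemma prob_univ {N : ℕ} (h : 0 < normConst θ κ N) : prob θ κ N Set.univ = 1 := by
  rw [prob_eq_mean]
  simpa using mean_const h 1

lemma prob_le_one (hθ : ∀ j : ℕ, 1 ≤ j → 0 ≤ θ j) (hκ : ∀ j : ℕ, 1 ≤ j → 0 ≤ κ j) {N : ℕ}
    (h : 0 < normConst θ κ N) (A : Set (Equiv.Perm (Fin N))) : prob θ κ N A ≤ 1 :=
  (prob_mono hθ hκ N (Set.subset_univ A)).trans (prob_univ h).le

lemma permMass_conj (θ κ : ℕ → ℝ) (N : ℕ) (σ τ : Equiv.Perm (Fin N)) :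
    permMass θ κ N (τ * σ * τ⁻¹) = permMass θ κ N σ := by
  simp only [permMass, cycleWeight, cycleCount_conj]

lemma prob_conj (θ κ : ℕ → ℝ) (N : ℕ) (τ : Equiv.Perm (Fin N)) (A : Set (Equiv.Perm (Fin N))) :
    prob θ κ N {σ | τ * σ * τ⁻¹ ∈ A} = prob θ κ N A := by
  rw [prob_eq_mean, prob_eq_mean, mean, mean, ← Equiv.sum_comp (MulAut.conj τ).toEquiv
    (fun σ => permMass θ κ N σ * A.indicator 1 σ)]
  refine Finset.sum_congr rfl fun σ _ => ?_
  have h1 : (MulAut.conj τ).toEquiv σ = τ * σ * τ⁻¹ := rfl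
  rw [h1, permMass_conj]
  rfl

/-- The symmetric group is transitive on injective `m`-tuples, and the measure is invariant under
conjugation. -/
lemma prob_cycleLength_eq_of_injective (θ κ : ℕ → ℝ) {N m : ℕ} (ℓ : Fin m → ℕ)
    (x y : Fin m ↪ Fin N) :
    prob θ κ N {σ | ∀ i, cycleLength σ (x i) = ℓ i} =
      prob θ κ N {σ | ∀ i, cycleLength σ (y i) = ℓ i} := by
  obtain ⟨τ, hτ⟩ := (Equiv.Perm.isMultiplyPretransitive (Fin N) m).exists_smul_eq x y
  rw [← prob_conj θ κ N τ {σ | ∀ i, cycleLength σ (y i) = ℓ i}]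
  congr 1
  ext σ
  refine forall_congr' fun i => ?_
  rw [← hτ]
  simp only [Function.Embedding.smul_apply, Equiv.Perm.smul_def, cycleLength_conj]

/-- For fixed `σ`, the number of tuples (repetitions allowed) with prescribed cycle lengths is a
product of counts over the coordinates. -/
lemma sum_prob_cycleLength (θ κ : ℕ → ℝ) (N : ℕ) {m : ℕ} (ℓ : Fin m → ℕ) :
    ∑ x : Fin m → Fin N, prob θ κ N {σ | ∀ i, cycleLength σ (x i) = ℓ i} =
      mean θ κ N fun σ => ∏ i, (ℓ i * cycleCount σ (ℓ i) : ℝ) := by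
  classical
  simp only [prob_eq_mean]
  rw [← mean_sum]
  congr 1
  funext σ
  have h : ∀ i, (ℓ i * cycleCount σ (ℓ i) : ℝ) = ∑ y : Fin N, if cycleLength σ y = ℓ i then 1 else 0 := by
    intro i
    rw [Finset.sum_boole, card_cycleLength_eq]
    push_cast
    rfl
  simp only [h]
  rw [Finset.prod_univ_sum]
  rw [Fintype.piFinset_univ]
  refine Finset.sum_congr rfl fun x _ => ?_
  rw [Finset.prod_ite_zero]
  by_cases hx : ∀ i, cycleLength σ (x i) = ℓ i
  · have hx' : σ ∈ {σ | ∀ i, cycleLength σ (x i) = ℓ i} := hx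
    refine (Set.indicator_of_mem hx' _).trans ?_
    simp [hx]
  · have hx' : σ ∉ {σ | ∀ i, cycleLength σ (x i) = ℓ i} := hx
    refine (Set.indicator_of_notMem hx' _).trans ?_
    simp [hx]

/-- The mean is an average over all `N ^ m` tuples. The injective ones all contribute the same
probability, so the error is at most the proportion of non-injective tuples. -/
lemma abs_prob_cycleLength_sub_le (hθ : ∀ j : ℕ, 1 ≤ j → 0 ≤ θ j) (hκ : ∀ j : ℕ, 1 ≤ j → 0 ≤ κ j)
    {N : ℕ} (hN : 0 < normConst θ κ N) (hN1 : 1 ≤ N) {m : ℕ} (ℓ : Fin m → ℕ) (y : Fin m ↪ Fin N) :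
    |prob θ κ N {σ | ∀ i, cycleLength σ (y i) = ℓ i} -
      mean θ κ N (fun σ => ∏ i, ((ℓ i * cycleCount σ (ℓ i) : ℝ) / N))| ≤
      1 - (N.descFactorial m : ℝ) / (N : ℝ) ^ m := by
  classical
  set a := prob θ κ N {σ | ∀ i, cycleLength σ (y i) = ℓ i} with ha
  set S : Finset (Fin m → Fin N) := Finset.univ.filter Function.Injective with hS
  have hcard : (S.card : ℝ) = N.descFactorial m := by
    have h1 : S.card = Fintype.card (Fin m ↪ Fin N) := by
      rw [hS, ← Fintype.card_subtype]
      exact Fintype.card_congr (Equiv.subtypeInjectiveEquivEmbedding _ _)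
    rw [h1, Fintype.card_embedding_eq]
    simp
  have hcardc : (Sᶜ.card : ℝ) = (N : ℝ) ^ m - N.descFactorial m := by
    have h1 := Finset.card_add_card_compl S
    rw [← hcard]
    have : ((S.card + Sᶜ.card : ℕ) : ℝ) = (N : ℝ) ^ m := by rw [h1]; simp
    push_cast at this
    linarith
  have hmean : mean θ κ N (fun σ => ∏ i, (ℓ i * cycleCount σ (ℓ i) : ℝ)) =
      (N : ℝ) ^ m * mean θ κ N (fun σ => ∏ i, ((ℓ i * cycleCount σ (ℓ i) : ℝ) / N)) := by
    rw [← mean_const_mul]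
    congr 1
    funext σ
    rw [Finset.prod_div_distrib, Finset.prod_const, Finset.card_univ, Fintype.card_fin]
    field_simp
  have hsum := sum_prob_cycleLength θ κ N ℓ
  rw [hmean, ← Finset.sum_add_sum_compl S] at hsum
  have h1 : ∑ x ∈ S, prob θ κ N {σ | ∀ i, cycleLength σ (x i) = ℓ i} =
      (N.descFactorial m : ℝ) * a := by
    rw [← hcard, ← nsmul_eq_mul, ← Finset.sum_const]
    refine Finset.sum_congr rfl fun x hx => ?_
    exact prob_cycleLength_eq_of_injective θ κ ℓ ⟨x, (Finset.mem_filter.1 hx).2⟩ y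
  have h2 : 0 ≤ ∑ x ∈ Sᶜ, prob θ κ N {σ | ∀ i, cycleLength σ (x i) = ℓ i} :=
    Finset.sum_nonneg fun x _ => prob_nonneg hθ hκ N _
  have h3 : ∑ x ∈ Sᶜ, prob θ κ N {σ | ∀ i, cycleLength σ (x i) = ℓ i} ≤ Sᶜ.card := by
    rw [← nsmul_one, ← Finset.sum_const]
    exact Finset.sum_le_sum fun x _ => prob_le_one hθ hκ hN _
  have ha0 : 0 ≤ a := prob_nonneg hθ hκ N _
  have ha1 : a ≤ 1 := prob_le_one hθ hκ hN _
  have hNm : (0 : ℝ) < (N : ℝ) ^ m := by positivity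
  have hc0 : (0 : ℝ) ≤ (N : ℝ) ^ m - N.descFactorial m := hcardc ▸ Nat.cast_nonneg _
  rw [h1] at hsum
  rw [hcardc] at h3
  have h4 : 1 - (N.descFactorial m : ℝ) / (N : ℝ) ^ m =
      ((N : ℝ) ^ m - N.descFactorial m) / (N : ℝ) ^ m := by field_simp
  rw [h4, le_div_iff₀ hNm, ← abs_of_pos hNm, ← abs_mul, abs_of_pos hNm, abs_le]
  constructor <;> nlinarith

lemma tendsto_descFactorial_div_pow (m : ℕ) :
    Tendsto (fun N : ℕ => (N.descFactorial m : ℝ) / (N : ℝ) ^ m) atTop (𝓝 1) := by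
  have h1 : Tendsto (fun N : ℕ => (1 - (m : ℝ) / N) ^ m) atTop (𝓝 1) := by
    have := ((tendsto_const_div_atTop_nhds_zero_nat (m : ℝ)).const_sub 1).pow m
    simpa using this
  refine tendsto_of_tendsto_of_tendsto_of_le_of_le' h1 tendsto_const_nhds ?_ ?_
  · filter_upwards [eventually_ge_atTop (m + 1)] with N hN
    have hN0 : (0 : ℝ) < N := by
      have : 0 < N := by omega
      exact_mod_cast this
    have h2 : (((N + 1 - m) ^ m : ℕ) : ℝ) ≤ N.descFactorial m := by
      exact_mod_cast Nat.pow_sub_le_descFactorial N m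
    rw [le_div_iff₀ (by positivity), ← mul_pow]
    refine le_trans ?_ h2
    push_cast
    rw [Nat.cast_sub (by omega)]
    push_cast
    have h3 : (1 - (m : ℝ) / N) * N = N - m := by field_simp
    rw [h3]
    have h4 : (m : ℝ) ≤ N := by
      have : m ≤ N := by omega
      exact_mod_cast this
    gcongr
    linarith
  · refine Eventually.of_forall fun N => ?_
    refine div_le_one_of_le₀ ?_ (by positivity)
    exact_mod_cast Nat.descFactorial_le_pow N m

/-- By exchangeability the `N - 1` candidates `c ≠ a` are equally likely to share a short cycle with
`a`, and such a cycle has at most `L` elements. -/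
lemma prob_sameCycle_le (hθ : ∀ j : ℕ, 1 ≤ j → 0 ≤ θ j) (hκ : ∀ j : ℕ, 1 ≤ j → 0 ≤ κ j)
    {N : ℕ} (hN : 0 < normConst θ κ N) (hN2 : 2 ≤ N) {a b : Fin N} (hab : a ≠ b) (L : ℕ) :
    prob θ κ N {σ | σ.SameCycle a b ∧ cycleLength σ a ≤ L} ≤ L / ((N : ℝ) - 1) := by
  classical
  have hN1 : (0 : ℝ) < (N : ℝ) - 1 := by
    have : (2 : ℝ) ≤ N := by exact_mod_cast hN2
    linarith
  have h1 : ∀ c ∈ Finset.univ.erase a, prob θ κ N {σ | σ.SameCycle a c ∧ cycleLength σ a ≤ L} =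
      prob θ κ N {σ | σ.SameCycle a b ∧ cycleLength σ a ≤ L} := by
    intro c hc
    have hca := Finset.ne_of_mem_erase hc
    rw [← prob_conj θ κ N (Equiv.swap c b) {σ | σ.SameCycle a b ∧ cycleLength σ a ≤ L}]
    have ha : Equiv.swap c b a = a := Equiv.swap_apply_of_ne_of_ne hca.symm hab
    congr 1
    ext σ
    have e1 := cycleLength_conj σ (Equiv.swap c b) a
    rw [ha] at e1
    have e2 : (Equiv.swap c b * σ * (Equiv.swap c b)⁻¹).SameCycle a b ↔ σ.SameCycle a c := by
      rw [Equiv.Perm.sameCycle_conj, Equiv.swap_inv, ha, Equiv.swap_apply_right]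
    exact and_congr e2.symm (by rw [e1])
  have h2 : ∑ c ∈ Finset.univ.erase a, prob θ κ N {σ | σ.SameCycle a c ∧ cycleLength σ a ≤ L} =
      ((N : ℝ) - 1) * prob θ κ N {σ | σ.SameCycle a b ∧ cycleLength σ a ≤ L} := by
    rw [Finset.sum_congr rfl h1, Finset.sum_const, Finset.card_erase_of_mem (Finset.mem_univ a),
      Finset.card_univ, Fintype.card_fin, nsmul_eq_mul, Nat.cast_sub (by omega), Nat.cast_one]
  have h3 : ∑ c ∈ Finset.univ.erase a, prob θ κ N {σ | σ.SameCycle a c ∧ cycleLength σ a ≤ L} ≤ L := by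
    simp only [prob_eq_mean]
    rw [← mean_sum]
    refine (mean_mono hθ hκ N fun σ => ?_).trans (mean_const hN (L : ℝ)).le
    by_cases hL : cycleLength σ a ≤ L
    · refine le_trans ?_ (Nat.cast_le.2 hL)
      calc ∑ c ∈ Finset.univ.erase a,
            ({σ | σ.SameCycle a c ∧ cycleLength σ a ≤ L} : Set (Equiv.Perm (Fin N))).indicator 1 σ
          ≤ ∑ c : Fin N, if σ.SameCycle a c then (1 : ℝ) else 0 := by
            refine (Finset.sum_le_sum fun c _ => ?_).trans (Finset.sum_le_sum_of_subset_of_nonneg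
              (Finset.subset_univ _) fun c _ _ => by split_ifs <;> norm_num)
            by_cases hc : σ.SameCycle a c
            · rw [if_pos hc]
              exact Set.indicator_le_self' (fun _ _ => zero_le_one) σ
            · rw [if_neg hc, Set.indicator_of_notMem fun h => hc h.1]
        _ = cycleLength σ a := by
            rw [Finset.sum_boole]
            unfold cycleLength
            congr!
    · refine (Finset.sum_eq_zero fun c _ => Set.indicator_of_notMem (fun h => hL h.2) _).trans_le ?_
      exact Nat.cast_nonneg L
  rw [le_div_iff₀ hN1, mul_comm, ← h2]
  exact h3

/-- The two events can differ only if two of the first `m` elements share a cycle of length at most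
`L`; a union bound over pairs finishes. -/
lemma abs_prob_lexLength_sub_le (hθ : ∀ j : ℕ, 1 ≤ j → 0 ≤ θ j) (hκ : ∀ j : ℕ, 1 ≤ j → 0 ≤ κ j)
    {N : ℕ} (hN : 0 < normConst θ κ N) (hN2 : 2 ≤ N) {m : ℕ} (hm : m ≤ N) (ℓ : Fin m → ℕ) (L : ℕ)
    (hL : ∀ i, ℓ i ≤ L) :
    |prob θ κ N {σ | ∀ i : Fin m, lexLength σ i = ℓ i} -
      prob θ κ N {σ | ∀ i : Fin m, cycleLength σ (Fin.castLE hm i) = ℓ i}| ≤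
      m * m * (L / ((N : ℝ) - 1)) := by
  classical
  set P : Finset (Fin m × Fin m) := Finset.univ.filter fun p => p.1 ≠ p.2
  set E : Fin m × Fin m → Set (Equiv.Perm (Fin N)) := fun p =>
    {σ | σ.SameCycle (Fin.castLE hm p.1) (Fin.castLE hm p.2) ∧ cycleLength σ (Fin.castLE hm p.1) ≤ L}
  have hE : ∑ p ∈ P, prob θ κ N (E p) ≤ m * m * (L / ((N : ℝ) - 1)) := by
    have hnn : (0 : ℝ) ≤ L / ((N : ℝ) - 1) := by
      have : (2 : ℝ) ≤ N := by exact_mod_cast hN2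
      exact div_nonneg (Nat.cast_nonneg _) (by linarith)
    calc ∑ p ∈ P, prob θ κ N (E p) ≤ ∑ _p ∈ P, (L / ((N : ℝ) - 1)) := by
          refine Finset.sum_le_sum fun p hp => ?_
          refine prob_sameCycle_le hθ hκ hN hN2 (fun h => ?_) L
          exact (Finset.mem_filter.1 hp).2 (Fin.castLE_injective hm h)
      _ ≤ ∑ _p : Fin m × Fin m, (L / ((N : ℝ) - 1)) :=
          Finset.sum_le_sum_of_subset_of_nonneg (Finset.subset_univ _) fun _ _ _ => hnn
      _ = _ := by simp
  refine le_trans ?_ hE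
  have hpt : ∀ σ : Equiv.Perm (Fin N), σ ∉ ⋃ p ∈ P, E p →
      ((∀ i : Fin m, lexLength σ i = ℓ i) ↔ ∀ i : Fin m, cycleLength σ (Fin.castLE hm i) = ℓ i) := by
    intro σ hσ
    simp only [Set.mem_iUnion, not_exists] at hσ
    by_cases hD : ∀ i j : Fin m, i ≠ j → ¬ σ.SameCycle (Fin.castLE hm i) (Fin.castLE hm j)
    · exact forall_congr' fun i => by rw [lexLength_of_distinct hm hD i]
    · push Not at hD
      obtain ⟨i, j, hij, hs⟩ := hD
      -- A shared cycle is now longer than `L`. It contains one of the first `m` elements, hence is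
      -- among the first `m` lexicographic cycles, so both events fail.
      have hbig : ¬ cycleLength σ (Fin.castLE hm i) ≤ L := fun h =>
        hσ (i, j) (Finset.mem_filter.2 ⟨Finset.mem_univ _, hij⟩) ⟨hs, h⟩
      constructor
      · intro h
        obtain ⟨k, hk, hkl⟩ := exists_lexLength_eq (σ := σ) (x := Fin.castLE hm i) (m := m) i.2
        refine absurd ?_ hbig
        rw [← hkl, h ⟨k, hk⟩]
        exact hL _
      · intro h
        exact absurd ((h i).trans_le (hL i)) hbig
  simp only [prob_eq_mean]
  rw [← mean_sub, ← mean_sum, abs_le, neg_le_iff_add_nonneg, ← mean_add]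
  set A : Set (Equiv.Perm (Fin N)) := {σ | ∀ i : Fin m, lexLength σ i = ℓ i}
  set B : Set (Equiv.Perm (Fin N)) := {σ | ∀ i : Fin m, cycleLength σ (Fin.castLE hm i) = ℓ i}
  have hpt' : ∀ σ : Equiv.Perm (Fin N), |A.indicator (1 : Equiv.Perm (Fin N) → ℝ) σ - B.indicator 1 σ| ≤
      ∑ p ∈ P, (E p).indicator 1 σ := by
    intro σ
    have hnn : ∀ p ∈ P, (0 : ℝ) ≤ (E p).indicator 1 σ := fun p _ =>
      Set.indicator_nonneg (fun _ _ => zero_le_one) σ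
    by_cases hσ : σ ∈ ⋃ p ∈ P, E p
    · simp only [Set.mem_iUnion] at hσ
      obtain ⟨p, hp, h⟩ := hσ
      have h1 := Finset.single_le_sum hnn hp
      rw [Set.indicator_of_mem h, Pi.one_apply] at h1
      refine le_trans ?_ h1
      by_cases hA : σ ∈ A <;> by_cases hB : σ ∈ B <;> simp [hA, hB]
    · have hAB : σ ∈ A ↔ σ ∈ B := hpt σ hσ
      have : A.indicator (1 : Equiv.Perm (Fin N) → ℝ) σ = B.indicator 1 σ := by
        by_cases hA : σ ∈ A
        · rw [Set.indicator_of_mem hA, Set.indicator_of_mem (hAB.1 hA)]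
        · rw [Set.indicator_of_notMem hA, Set.indicator_of_notMem fun h => hA (hAB.2 h)]
      rw [this, sub_self, abs_zero]
      exact Finset.sum_nonneg hnn
  constructor
  · refine Finset.sum_nonneg fun σ _ => mul_nonneg (permMass_nonneg hθ hκ N σ) ?_
    have := (abs_le.1 (hpt' σ)).1
    linarith
  · exact mean_mono hθ hκ N fun σ => (abs_le.1 (hpt' σ)).2

/-- The limit of the joint distribution of the first `m` lexicographic cycle lengths. -/
lemma tendsto_prob_lexLength_eq {r : ℝ} (hθ : ∀ j : ℕ, 1 ≤ j → 0 ≤ θ j)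
    (hκ : ∀ j : ℕ, 1 ≤ j → 0 ≤ κ j) (hna : NonArithmetic κ) (hr : IsCriticalRadius θ κ r)
    {m : ℕ} (ℓ : Fin m → ℕ) :
    Tendsto (fun N : ℕ => prob θ κ N {σ | ∀ i : Fin m, lexLength σ i = ℓ i})
      atTop (𝓝 (∏ i, limitWeight κ r (ℓ i))) := by
  have h1 := tendsto_mean_prod_cycleCount hθ hκ hna hr ℓ
  set L := ∑ i, ℓ i
  have hL : ∀ i, ℓ i ≤ L := fun i => Finset.single_le_sum (fun _ _ => Nat.zero_le _) (Finset.mem_univ i)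
  have herr : Tendsto (fun N : ℕ => (m * m * (L / ((N : ℝ) - 1)) : ℝ) +
      (1 - (N.descFactorial m : ℝ) / (N : ℝ) ^ m)) atTop (𝓝 0) := by
    have e1 : Tendsto (fun N : ℕ => (L : ℝ) / ((N : ℝ) - 1)) atTop (𝓝 0) :=
      (tendsto_const_nhds).div_atTop
        (tendsto_atTop_add_const_right _ (-1) tendsto_natCast_atTop_atTop)
    simpa using (e1.const_mul (m * m : ℝ)).add ((tendsto_descFactorial_div_pow m).const_sub 1)
  refine tendsto_of_tendsto_of_dist h1 (squeeze_zero' (Eventually.of_forall fun _ => dist_nonneg)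
    ?_ herr)
  filter_upwards [eventually_normConst_pos hθ hκ hna hr, eventually_ge_atTop (m + 2)] with N hN hN2
  have hm : m ≤ N := by omega
  rw [dist_comm, Real.dist_eq]
  refine (abs_sub_le _ _ _).trans (add_le_add
    (abs_prob_lexLength_sub_le hθ hκ hN (by omega) hm ℓ L hL) ?_)
  exact abs_prob_cycleLength_sub_le hθ hκ hN (by omega) ℓ (Fin.castLEEmb hm)

end

/-! ### Joint limits and asymptotic independence -/

section

variable {θ κ : ℕ → ℝ} {r : ℝ}

lemma prob_lexLength_mem_finset (θ κ : ℕ → ℝ) (N : ℕ) {m : ℕ} (A : Fin m → Finset ℕ) :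
    prob θ κ N {σ | ∀ i : Fin m, lexLength σ i ∈ A i} =
      ∑ ℓ ∈ Fintype.piFinset A, prob θ κ N {σ | ∀ i : Fin m, lexLength σ i = ℓ i} := by
  simp only [prob_eq_mean]
  rw [← mean_sum]
  congr 1
  funext σ
  have hne : ∀ ℓ : Fin m → ℕ, ℓ ≠ (fun i : Fin m => lexLength σ i) →
      ({σ | ∀ i : Fin m, lexLength σ i = ℓ i} : Set (Equiv.Perm (Fin N))).indicator
        (1 : Equiv.Perm (Fin N) → ℝ) σ = 0 := by
    intro ℓ hℓ
    refine Set.indicator_of_notMem (fun h => hℓ ?_) _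
    funext i
    exact (h i).symm
  by_cases h : σ ∈ {σ : Equiv.Perm (Fin N) | ∀ i : Fin m, lexLength σ i ∈ A i}
  · rw [Set.indicator_of_mem h, Finset.sum_eq_single (fun i : Fin m => lexLength σ i)]
    · exact (Set.indicator_of_mem (s := {σ' : Equiv.Perm (Fin N) |
        ∀ i : Fin m, lexLength σ' i = lexLength σ i}) (fun _ => rfl) _).symm
    · exact fun ℓ _ hℓ => hne ℓ hℓ
    · exact fun h' => absurd (Fintype.mem_piFinset.2 h) h'
  · rw [Set.indicator_of_notMem h]
    refine (Finset.sum_eq_zero fun ℓ hℓ => hne ℓ fun heq => h ?_).symm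
    subst heq
    exact Fintype.mem_piFinset.1 hℓ

lemma tendsto_prob_lexLength_mem_finset (hθ : ∀ j : ℕ, 1 ≤ j → 0 ≤ θ j)
    (hκ : ∀ j : ℕ, 1 ≤ j → 0 ≤ κ j) (hna : NonArithmetic κ) (hr : IsCriticalRadius θ κ r)
    {m : ℕ} (A : Fin m → Finset ℕ) :
    Tendsto (fun N : ℕ => prob θ κ N {σ | ∀ i : Fin m, lexLength σ i ∈ A i})
      atTop (𝓝 (∏ i, ∑ j ∈ A i, limitWeight κ r j)) := by
  simp only [prob_lexLength_mem_finset]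
  rw [Finset.prod_univ_sum]
  exact tendsto_finsetSum _ fun ℓ _ => tendsto_prob_lexLength_eq hθ hκ hna hr ℓ

/-- All the events are finite boxes, so numerators and denominators converge to products. The
conditioning event has limit `q ^ m > 0`, and in a marginal every other coordinate contributes `q /
q = 1`. -/
lemma tendsto_condProb_sub_prod (hθ : ∀ j : ℕ, 1 ≤ j → 0 ≤ θ j)
    (hκ : ∀ j : ℕ, 1 ≤ j → 0 ≤ κ j) (hna : NonArithmetic κ) (hr : IsCriticalRadius θ κ r)
    {m M : ℕ} (hM : ∃ j : ℕ, 1 ≤ j ∧ j ≤ M ∧ 0 < κ j) (ℓ : Fin m → ℕ) :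
    Tendsto (fun N : ℕ =>
      condProb θ κ N {σ | ∀ i : Fin m, lexLength σ i = ℓ i} {σ | ∀ i : Fin m, lexLength σ i ≤ M}
        - ∏ i : Fin m, condProb θ κ N {σ | lexLength σ i = ℓ i}
            {σ | ∀ k : Fin m, lexLength σ k ≤ M}) atTop (𝓝 0) := by
  have hr0 := hr.pos
  set B : Finset ℕ := Finset.range (M + 1)
  set C : Fin m → Finset ℕ := fun i => B.filter (· = ℓ i)
  set q := ∑ j ∈ B, limitWeight κ r j with hq
  set a : Fin m → ℝ := fun i => ∑ j ∈ C i, limitWeight κ r j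
  have hq0 : 0 < q := by
    obtain ⟨j, hj1, hjM, hj⟩ := hM
    refine Finset.sum_pos' (fun i _ => limitWeight_nonneg hκ hr0.le i)
      ⟨j, Finset.mem_range.2 (by omega), ?_⟩
    rw [limitWeight, if_neg (by omega)]
    positivity
  have hB : Tendsto (fun N : ℕ => prob θ κ N {σ | ∀ k : Fin m, lexLength σ k ≤ M})
      atTop (𝓝 (q ^ m)) := by
    have := tendsto_prob_lexLength_mem_finset hθ hκ hna hr (fun _ : Fin m => B)
    simpa [B, Nat.lt_succ_iff] using this
  have hjoint : Tendsto (fun N : ℕ => condProb θ κ N {σ | ∀ i : Fin m, lexLength σ i = ℓ i}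
      {σ | ∀ i : Fin m, lexLength σ i ≤ M}) atTop (𝓝 (∏ i, a i / q)) := by
    have h1 := (tendsto_prob_lexLength_mem_finset hθ hκ hna hr C).div hB (by positivity)
    have h2 : ∏ i, a i / q = (∏ i, a i) / q ^ m := by
      rw [Finset.prod_div_distrib]
      simp
    rw [h2]
    refine h1.congr fun N => ?_
    rw [condProb, Pi.div_apply]
    congr 2
    ext σ
    simp only [Set.mem_ofPred_eq, Set.mem_inter_iff, C, B, Finset.mem_filter, Finset.mem_range,
      Nat.lt_succ_iff, forall_and, and_comm]
  have hmarg : ∀ i : Fin m, Tendsto (fun N : ℕ => condProb θ κ N {σ | lexLength σ i = ℓ i}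
      {σ | ∀ k : Fin m, lexLength σ k ≤ M}) atTop (𝓝 (a i / q)) := by
    intro i
    have h1 := (tendsto_prob_lexLength_mem_finset hθ hκ hna hr
      (fun k => if k = i then C i else B)).div hB (by positivity)
    have h2 : a i / q = (∏ k, ∑ j ∈ if k = i then C i else B, limitWeight κ r j) / q ^ m := by
      have : q ^ m = ∏ _k : Fin m, q := by simp
      rw [this, ← Finset.prod_div_distrib, Finset.prod_eq_single i]
      · rw [if_pos rfl]
      · intro k _ hk
        rw [if_neg hk, ← hq, div_self hq0.ne']
      · simp
    rw [h2]
    refine h1.congr fun N => ?_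
    rw [condProb, Pi.div_apply]
    congr 2
    ext σ
    simp only [Set.mem_ofPred_eq, Set.mem_inter_iff]
    constructor
    · intro h
      have hi := h i
      rw [if_pos rfl, Finset.mem_filter] at hi
      refine ⟨hi.2, fun k => ?_⟩
      have hk := h k
      split_ifs at hk with hki
      · subst hki
        exact Nat.lt_succ_iff.1 (Finset.mem_range.1 (Finset.mem_filter.1 hk).1)
      · exact Nat.lt_succ_iff.1 (Finset.mem_range.1 hk)
    · rintro ⟨h, hle⟩ k
      have hk : lexLength σ k ∈ B := Finset.mem_range.2 (Nat.lt_succ_iff.2 (hle k))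
      split_ifs with hki
      · subst hki
        exact Finset.mem_filter.2 ⟨hk, h⟩
      · exact hk
  have := hjoint.sub (tendsto_finsetProd Finset.univ fun i _ => hmarg i)
  rwa [sub_self] at this

/-- If the limit law is proper, the joint distribution converges on arbitrary product sets. -/
lemma tendsto_prob_lexLength_mem (hθ : ∀ j : ℕ, 1 ≤ j → 0 ≤ θ j)
    (hκ : ∀ j : ℕ, 1 ≤ j → 0 ≤ κ j) (hna : NonArithmetic κ) (hr : IsCriticalRadius θ κ r)
    (h1 : HasSum (limitWeight κ r) 1) {m : ℕ} (A : Fin m → Set ℕ) :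
    Tendsto (fun N : ℕ => prob θ κ N {σ | ∀ i : Fin m, lexLength σ i ∈ A i})
      atTop (𝓝 (∏ i, ∑' j, (A i).indicator (limitWeight κ r) j)) := by
  classical
  set B : ℕ → Finset ℕ := fun M => Finset.range M
  set C : ℕ → Fin m → Finset ℕ := fun M i => (B M).filter (· ∈ A i)
  have hB : ∀ M, Tendsto (fun N : ℕ => prob θ κ N {σ | ∀ i : Fin m, lexLength σ i ∈ B M})
      atTop (𝓝 ((∑ j ∈ B M, limitWeight κ r j) ^ m)) := fun M => by
    simpa only [Finset.prod_const, Finset.card_univ, Fintype.card_fin] using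
      tendsto_prob_lexLength_mem_finset hθ hκ hna hr (fun _ : Fin m => B M)
  have hC := fun M => tendsto_prob_lexLength_mem_finset hθ hκ hna hr (C M)
  have hlow : Tendsto (fun M => ∏ i, ∑ j ∈ C M i, limitWeight κ r j) atTop
      (𝓝 (∏ i, ∑' j, (A i).indicator (limitWeight κ r) j)) := by
    refine tendsto_finsetProd _ fun i _ => ?_
    have := (h1.summable.indicator (A i)).hasSum.tendsto_sum_nat
    refine this.congr fun M => ?_
    rw [Finset.sum_filter]
    rfl
  have hone : Tendsto (fun M => 1 - (∑ j ∈ B M, limitWeight κ r j) ^ m) atTop (𝓝 0) := by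
    have := (h1.tendsto_sum_nat.pow m).const_sub 1
    simpa using this
  have hup := hlow.add hone
  rw [add_zero] at hup
  -- From below, the sets are truncated at `M`. From above, the probability of leaving the box `[0,
  -- M) ^ m` is added; its limit `1 - (∑ j < M) ^ m` vanishes as `M` grows because the total mass is
  -- one.
  rw [tendsto_order]
  constructor
  · intro a ha
    obtain ⟨M, hM⟩ := (hlow.eventually_const_lt ha).exists
    filter_upwards [(hC M).eventually_const_lt hM] with N hN
    exact hN.trans_le (prob_mono hθ hκ N fun σ h i => (Finset.mem_filter.1 (h i)).2)
  · intro b hb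
    obtain ⟨M, hM⟩ := (hup.eventually_lt_const hb).exists
    filter_upwards [((hC M).add ((hB M).const_sub 1)).eventually_lt_const hM,
      eventually_normConst_pos hθ hκ hna hr] with N hN hpos
    refine lt_of_le_of_lt ?_ hN
    rw [← prob_univ hpos]
    simp only [prob_eq_mean]
    rw [← mean_sub, ← mean_add]
    refine mean_mono hθ hκ N fun σ => ?_
    by_cases hBσ : σ ∈ {σ : Equiv.Perm (Fin N) | ∀ i : Fin m, lexLength σ i ∈ B M}
    · rw [Set.indicator_of_mem hBσ, Set.indicator_of_mem (Set.mem_univ σ), sub_self, add_zero]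
      by_cases hA : σ ∈ {σ : Equiv.Perm (Fin N) | ∀ i : Fin m, lexLength σ i ∈ A i}
      · rw [Set.indicator_of_mem hA, Set.indicator_of_mem]
        exact fun i => Finset.mem_filter.2 ⟨hBσ i, hA i⟩
      · rw [Set.indicator_of_notMem hA]
        exact Set.indicator_nonneg (fun _ _ => zero_le_one) σ
    · rw [Set.indicator_of_notMem hBσ, Set.indicator_of_mem (Set.mem_univ σ), sub_zero]
      refine (Set.indicator_le_self' (fun _ _ => zero_le_one) σ).trans ?_
      exact le_add_of_nonneg_left (Set.indicator_nonneg (fun _ _ => zero_le_one) σ)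

lemma tendsto_prob_sub_prod (hθ : ∀ j : ℕ, 1 ≤ j → 0 ≤ θ j)
    (hκ : ∀ j : ℕ, 1 ≤ j → 0 ≤ κ j) (hna : NonArithmetic κ) (hr : IsCriticalRadius θ κ r)
    (h1 : HasSum (limitWeight κ r) 1) {m : ℕ} (A : Fin m → Set ℕ) :
    Tendsto (fun N : ℕ => prob θ κ N {σ | ∀ i : Fin m, lexLength σ i ∈ A i} -
      ∏ i : Fin m, prob θ κ N {σ | lexLength σ i ∈ A i}) atTop (𝓝 0) := by
  classical
  have hmarg : ∀ i : Fin m, Tendsto (fun N : ℕ => prob θ κ N {σ | lexLength σ i ∈ A i}) atTop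
      (𝓝 (∑' j, (A i).indicator (limitWeight κ r) j)) := by
    intro i
    have h2 := tendsto_prob_lexLength_mem hθ hκ hna hr h1
      (fun k => if k = i then A i else Set.univ)
    have h3 : ∏ k, ∑' j, (if k = i then A i else Set.univ).indicator (limitWeight κ r) j =
        ∑' j, (A i).indicator (limitWeight κ r) j := by
      rw [Finset.prod_eq_single i]
      · rw [if_pos rfl]
      · intro k _ hk
        rw [if_neg hk, Set.indicator_univ, h1.tsum_eq]
      · simp
    rw [h3] at h2
    refine h2.congr fun N => ?_
    congr 1
    ext σ
    simp only [Set.mem_ofPred_eq]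
    constructor
    · intro h
      simpa using h i
    · intro h k
      split_ifs with hk
      · exact hk ▸ h
      · exact Set.mem_univ _
  have := (tendsto_prob_lexLength_mem hθ hκ hna hr h1 A).sub
    (tendsto_finsetProd Finset.univ fun i _ => hmarg i)
  rwa [sub_self] at this

end

lemma hasSum_prod_pow {ι : Type*} {f : ι → ℝ} (hf : ∀ x, 0 ≤ f x) {S : ℝ} (h : HasSum f S) (m : ℕ) :
    HasSum (fun ℓ : Fin m → ι => ∏ i, f (ℓ i)) (S ^ m) := by
  induction m with
  | zero => simp
  | succ m ih =>
    have hs := h.summable.mul_of_nonneg ih.summable hf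
      fun ℓ => Finset.prod_nonneg fun i _ => hf (ℓ i)
    have h2 := h.mul ih hs
    rw [← (Fin.consEquiv fun _ : Fin (m + 1) => ι).hasSum_iff, pow_succ']
    refine h2.congr_fun fun p => ?_
    simp [Fin.consEquiv, Fin.prod_univ_succ]

/-! ### The radius `r_*` -/

lemma AnalyticConditions.radius {θ κ : ℕ → ℝ} (h : AnalyticConditions θ κ) :
    0 < genRadius κ ∧ genRadius κ ≤ genRadius θ := by
  have aux : ∀ R : ℝ, 0 < R → genRadius κ = ENNReal.ofReal R → ENNReal.ofReal R ≤ genRadius θ →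
      0 < genRadius κ ∧ genRadius κ ≤ genRadius θ := fun R hR h1 h2 =>
    ⟨by rw [h1]; exact ENNReal.ofReal_pos.2 hR, h1.trans_le h2⟩
  rcases h with h | h | h | h | h | h
  · exact ⟨h.1, h.2.1⟩
  · obtain ⟨R, η, φ, θs, δ, Fθ, Fκ, hR, hk, -, -, -, -, -, hF, -⟩ := h
    exact aux R hR hk hF.1
  · obtain ⟨R, η, φ, s, as, δ, Fθ, Fκ, hR, hk, -, -, -, -, -, -, -, hF, -⟩ := h
    exact aux R hR hk hF.1
  · obtain ⟨R, hR, hk, hF, -⟩ := h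
    exact aux R hR hk hF
  · obtain ⟨R, η, φ, θs, δ, Fθ, Fκ, hR, hk, -, -, -, -, -, hF, -⟩ := h
    exact aux R hR hk hF.1
  · obtain ⟨R, η, φ, θs, s, as, δ, Fθ, Fκ, hR, hk, -, -, -, -, -, -, -, -, hF, -⟩ := h
    exact aux R hR hk hF.1

lemma norm_ofScalars_genCoeff {a : ℕ → ℝ} (ha : ∀ j : ℕ, 1 ≤ j → 0 ≤ a j) (j : ℕ) :
    ‖FormalMultilinearSeries.ofScalars ℂ (fun j => ((genCoeff a j : ℝ) : ℂ)) j‖ = genCoeff a j := by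
  rw [FormalMultilinearSeries.ofScalars_norm, Complex.norm_real, Real.norm_of_nonneg]
  unfold genCoeff
  split_ifs with h
  · exact le_rfl
  · have := ha j (Nat.one_le_iff_ne_zero.2 h)
    positivity

lemma natCast_mul_genCoeff_mul_pow (a : ℕ → ℝ) (j : ℕ) (x : ℝ) :
    j * (genCoeff a j * x ^ j) = limitWeight a x j := by
  unfold genCoeff limitWeight
  split_ifs with h
  · simp
  · have : (j : ℝ) ≠ 0 := by exact_mod_cast h
    field_simp

lemma modDeriv_one_ofReal {κ : ℕ → ℝ} {x : ℝ} (hx : 0 ≤ x) :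
    modDeriv κ 1 (ENNReal.ofReal x) = ∑' j, ENNReal.ofReal (limitWeight κ x j) := by
  unfold modDeriv
  refine tsum_congr fun j => ?_
  rw [Nat.descFactorial_one, ← natCast_mul_genCoeff_mul_pow, ← ENNReal.ofReal_pow hx,
    ← ENNReal.ofReal_natCast, mul_assoc, ← ENNReal.ofReal_mul' (by positivity),
    ← ENNReal.ofReal_mul (Nat.cast_nonneg j)]

lemma sum_Icc_eq_sum_limitWeight (κ : ℕ → ℝ) (x : ℝ) (J : ℕ) :
    ∑ j ∈ Finset.Icc 1 J, κ j * x ^ j = ∑ j ∈ Finset.range (J + 1), limitWeight κ x j := by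
  symm
  rw [Finset.sum_range_eq_add_Ico _ (Nat.succ_pos J)]
  have : limitWeight κ x 0 = 0 := if_pos rfl
  rw [this, zero_add]
  refine Finset.sum_congr rfl fun j hj => ?_
  rw [limitWeight, if_neg]
  have := (Finset.mem_Icc.1 hj).1
  omega

section

variable {θ κ : ℕ → ℝ}

lemma ofReal_sum_le_modDeriv (hκ : ∀ j : ℕ, 1 ≤ j → 0 ≤ κ j) {x : ℝ} (hx : 0 ≤ x) (J : ℕ) :
    ENNReal.ofReal (∑ j ∈ Finset.Icc 1 J, κ j * x ^ j) ≤ modDeriv κ 1 (ENNReal.ofReal x) := by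
  rw [sum_Icc_eq_sum_limitWeight, modDeriv_one_ofReal hx,
    ENNReal.ofReal_sum_of_nonneg fun j _ => limitWeight_nonneg hκ hx j]
  exact ENNReal.sum_le_tsum _

lemma modDeriv_le_one (hκ : ∀ j : ℕ, 1 ≤ j → 0 ≤ κ j) {x : ℝ} (hx : 0 ≤ x)
    (h : ∀ J, ∑ j ∈ Finset.Icc 1 J, κ j * x ^ j ≤ 1) : modDeriv κ 1 (ENNReal.ofReal x) ≤ 1 := by
  rw [modDeriv_one_ofReal hx]
  refine ENNReal.tsum_le_of_sum_range_le fun n => ?_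
  rw [← ENNReal.ofReal_sum_of_nonneg fun j _ => limitWeight_nonneg hκ hx j, ← ENNReal.ofReal_one]
  refine ENNReal.ofReal_le_ofReal (le_trans ?_ (h n))
  rw [sum_Icc_eq_sum_limitWeight]
  exact Finset.sum_le_sum_of_subset_of_nonneg (Finset.range_mono n.le_succ)
    fun j _ _ => limitWeight_nonneg hκ hx j

/-- Each term of index `j ≥ 1` grows at least by the factor `y / x > 1`. In extended reals the
comparison also covers divergence at `y`. -/
lemma one_lt_modDeriv_of_lt (hκ : ∀ j : ℕ, 1 ≤ j → 0 ≤ κ j) {x y : ℝ} (hx : 0 < x) (hxy : x < y)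
    (h : modDeriv κ 1 (ENNReal.ofReal x) = 1) : 1 < modDeriv κ 1 (ENNReal.ofReal y) := by
  have hy : 0 < y := hx.trans hxy
  have h1 : 1 < ENNReal.ofReal (y / x) := by
    rw [← ENNReal.ofReal_one]
    exact (ENNReal.ofReal_lt_ofReal_iff (by positivity)).2 ((one_lt_div hx).2 hxy)
  refine h1.trans_le ?_
  rw [← mul_one (ENNReal.ofReal (y / x)), ← h, modDeriv_one_ofReal hx.le,
    modDeriv_one_ofReal hy.le, ← ENNReal.tsum_mul_left]
  refine ENNReal.tsum_le_tsum fun j => ?_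
  rw [← ENNReal.ofReal_mul (by positivity)]
  refine ENNReal.ofReal_le_ofReal ?_
  unfold limitWeight
  split_ifs with hj
  · simp
  · obtain ⟨i, rfl⟩ := Nat.exists_eq_succ_of_ne_zero hj
    have := hκ (i + 1) (by omega)
    calc y / x * (κ (i + 1) * x ^ (i + 1)) = κ (i + 1) * (x ^ i * y) := by
          field_simp
          ring
      _ ≤ κ (i + 1) * (y ^ i * y) := by gcongr
      _ = _ := by rw [Nat.succ_eq_add_one, pow_succ]

lemma summable_limitWeight (hκ : ∀ j : ℕ, 1 ≤ j → 0 ≤ κ j) {x : ℝ} (hx : 0 ≤ x)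
    (hxR : ENNReal.ofReal x < genRadius κ) : Summable (limitWeight κ x) := by
  obtain ⟨a, ha, C, hC, h⟩ := FormalMultilinearSeries.norm_mul_pow_le_mul_pow_of_lt_radius _ hxR
  have hs : Summable fun j : ℕ => C * ((j : ℝ) ^ 1 * a ^ j) :=
    (summable_pow_mul_geometric_of_norm_lt_one 1 (by
      rw [Real.norm_of_nonneg ha.1.le]; exact ha.2)).mul_left C
  refine Summable.of_nonneg_of_le (fun j => limitWeight_nonneg hκ hx j) (fun j => ?_) hs
  have hj := h j
  rw [norm_ofScalars_genCoeff hκ, Real.coe_toNNReal x hx] at hj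
  rw [← natCast_mul_genCoeff_mul_pow, pow_one]
  calc (j : ℝ) * (genCoeff κ j * x ^ j) ≤ j * (C * a ^ j) := by gcongr
    _ = _ := by ring

lemma IsRStar.modDeriv_le_one {r : ℝ} (h : IsRStar κ r) :
    modDeriv κ 1 (ENNReal.ofReal r) ≤ 1 := by
  rcases le_or_gt 1 (modDeriv κ 1 (genRadius κ)) with h1 | h1
  · exact (h.2.2.1 h1).le
  · rw [h.2.2.2 h1]
    exact h1.le

/-- Beyond `r` the partial sums must exceed one: either `r` is the root and the series grows
strictly, or `r = R` and bounded partial sums at `y > R` would enlarge the radius of convergence. -/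
lemma IsRStar.isCriticalRadius {r : ℝ} (hθ : ∀ j : ℕ, 1 ≤ j → 0 ≤ θ j)
    (hκ : ∀ j : ℕ, 1 ≤ j → 0 ≤ κ j) (hR : genRadius κ ≤ genRadius θ) (h : IsRStar κ r) :
    IsCriticalRadius θ κ r where
  pos := h.1
  sum_le J := by
    have h1 := (ofReal_sum_le_modDeriv hκ h.1.le J).trans h.modDeriv_le_one
    rwa [ENNReal.ofReal_le_one] at h1
  lt_sum y hy := by
    by_contra hcon
    push Not at hcon
    have hy0 : 0 < y := h.1.trans hy
    have hle := SurrogateSpatial.modDeriv_le_one hκ hy0.le hcon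
    rcases le_or_gt 1 (modDeriv κ 1 (genRadius κ)) with h1 | h1
    · exact absurd hle (not_le.2 (one_lt_modDeriv_of_lt hκ h.1 hy (h.2.2.1 h1)))
    · have h2 : ENNReal.ofReal y ≤ genRadius κ := by
        refine FormalMultilinearSeries.le_radius_of_bound _ 1 fun j => ?_
        rw [norm_ofScalars_genCoeff hκ, Real.coe_toNNReal y hy0.le]
        unfold genCoeff
        split_ifs with hj
        · simp
        · have hj1 : 1 ≤ j := Nat.one_le_iff_ne_zero.2 hj
          refine le_trans ?_ (hcon j)
          have h3 := Finset.single_le_sum (f := fun j => κ j * y ^ j) (fun i hi => by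
            have := hκ i (Finset.mem_Icc.1 hi).1
            positivity) (Finset.mem_Icc.2 ⟨hj1, le_rfl⟩)
          refine le_trans ?_ h3
          have := hκ j hj1
          have : κ j / j ≤ κ j := div_le_self this (by exact_mod_cast hj1)
          gcongr
      rw [← h.2.2.2 h1, ENNReal.ofReal_le_ofReal_iff h.1.le] at h2
      exact absurd hy (not_lt.2 h2)
  bdd x hx hxr := by
    have hxR : ENNReal.ofReal x < genRadius θ :=
      ((ENNReal.ofReal_lt_ofReal_iff h.1).2 hxr).trans_le (h.2.1.trans hR)
    have hs := FormalMultilinearSeries.summable_norm_mul_pow _ hxR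
    refine ⟨_, fun J => le_trans (le_of_eq ?_) (hs.sum_le_tsum (Finset.Icc 1 J)
      fun j _ => by positivity)⟩
    refine Finset.sum_congr rfl fun j hj => ?_
    rw [norm_ofScalars_genCoeff hθ, Real.coe_toNNReal x hx.le, genCoeff,
      if_neg (by have := (Finset.mem_Icc.1 hj).1; omega)]
    ring

lemma IsRStar.unique {r r' : ℝ} (hκ : ∀ j : ℕ, 1 ≤ j → 0 ≤ κ j) (h : IsRStar κ r)
    (h' : IsRStar κ r') : r' = r := by
  rcases le_or_gt 1 (modDeriv κ 1 (genRadius κ)) with h1 | h1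
  · have e := h.2.2.1 h1
    have e' := h'.2.2.1 h1
    rcases lt_trichotomy r' r with hlt | heq | hlt
    · exact absurd e (one_lt_modDeriv_of_lt hκ h'.1 hlt e').ne'
    · exact heq
    · exact absurd e' (one_lt_modDeriv_of_lt hκ h.1 hlt e).ne'
  · have := (h'.2.2.2 h1).trans (h.2.2.2 h1).symm
    rwa [ENNReal.ofReal_eq_ofReal_iff h'.1.le h.1.le] at this

lemma exists_modDeriv_eq_one (hκ : ∀ j : ℕ, 1 ≤ j → 0 ≤ κ j) {x : ℝ} (hx : 0 < x)
    (hxR : ENNReal.ofReal x < genRadius κ) {J : ℕ} (h : 1 < ∑ j ∈ Finset.Icc 1 J, κ j * x ^ j) :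
    ∃ r, 0 < r ∧ r ≤ x ∧ modDeriv κ 1 (ENNReal.ofReal r) = 1 := by
  have hs := summable_limitWeight hκ hx.le hxR
  have hmono : ∀ y ∈ Set.Icc 0 x, ∀ j, limitWeight κ y j ≤ limitWeight κ x j := by
    intro y hy j
    unfold limitWeight
    split_ifs with hj
    · exact le_rfl
    · have := hκ j (Nat.one_le_iff_ne_zero.2 hj)
      have := hy.1
      have := hy.2
      gcongr
  have hcont : ContinuousOn (fun y => ∑' j, limitWeight κ y j) (Set.Icc 0 x) := by
    refine continuousOn_tsum (fun j => ?_) hs fun j y hy => ?_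
    · unfold limitWeight
      split_ifs <;> fun_prop
    · rw [Real.norm_of_nonneg (limitWeight_nonneg hκ hy.1 j)]
      exact hmono y hy j
  have h0 : ∑' j, limitWeight κ 0 j = 0 := by
    have : ∀ j, limitWeight κ 0 j = 0 := fun j => by
      unfold limitWeight
      split_ifs with hj
      · rfl
      · rw [zero_pow hj, mul_zero]
    simp [this]
  have hx1 : 1 ≤ ∑' j, limitWeight κ x j := by
    rw [sum_Icc_eq_sum_limitWeight] at h
    exact h.le.trans (hs.sum_le_tsum _ fun j _ => limitWeight_nonneg hκ hx.le j)
  obtain ⟨r, hr, hr1⟩ := intermediate_value_Icc hx.le hcont (show (1 : ℝ) ∈ Set.Icc _ _ from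
    ⟨by rw [h0]; exact zero_le_one, hx1⟩)
  have hr0 : r ≠ 0 := by
    rintro rfl
    simp only [h0] at hr1
    exact zero_ne_one hr1
  refine ⟨r, lt_of_le_of_ne hr.1 hr0.symm, hr.2, ?_⟩
  have hsr : Summable (limitWeight κ r) :=
    Summable.of_nonneg_of_le (fun j => limitWeight_nonneg hκ hr.1 j) (hmono r hr) hs
  rw [modDeriv_one_ofReal hr.1, ← ENNReal.ofReal_tsum_of_nonneg
    (fun j => limitWeight_nonneg hκ hr.1 j) hsr]
  simp only at hr1
  rw [hr1, ENNReal.ofReal_one]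

/-- Finite partial sums are continuous on `[0, ∞]`, so the bound passes to the left limit, also at
`R = ∞`. -/
lemma modDeriv_le_of_forall_lt {R : ℝ≥0∞} (hR : 0 < R) {n : ℕ} {c : ℝ≥0∞}
    (h : ∀ x < R, modDeriv κ n x ≤ c) : modDeriv κ n R ≤ c := by
  unfold modDeriv
  refine ENNReal.tsum_le_of_sum_range_le fun k => ?_
  have hcont : Continuous fun x : ℝ≥0∞ => ∑ j ∈ Finset.range k,
      (j.descFactorial n : ℝ≥0∞) * ENNReal.ofReal (genCoeff κ j) * x ^ j :=
    continuous_finsetSum _ fun j _ => (ENNReal.continuous_const_mul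
      (ENNReal.mul_ne_top (ENNReal.natCast_ne_top _) ENNReal.ofReal_ne_top)).comp
        (ENNReal.continuous_pow j)
  have : (𝓝[<] R).NeBot := nhdsLT_neBot_of_exists_lt ⟨0, hR⟩
  refine le_of_tendsto (hcont.continuousAt.tendsto.mono_left (nhdsWithin_le_nhds (s := Set.Iio R))) ?_
  filter_upwards [self_mem_nhdsWithin] with x hx
  exact (ENNReal.sum_le_tsum _).trans (h x hx)

/-- If some partial sum exceeds one inside the disk, the intermediate value theorem gives the root.
Otherwise the value at `R` is at most one, which forces `R < ∞`, and `r = R` serves both for value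
one and for smaller values. -/
lemma exists_isRStar (hκ : ∀ j : ℕ, 1 ≤ j → 0 ≤ κ j) (hpos : ∃ j : ℕ, 1 ≤ j ∧ 0 < κ j)
    (hR0 : 0 < genRadius κ) :
    ∃ r, IsRStar κ r := by
  by_cases hex : ∃ x : ℝ, 0 < x ∧ ENNReal.ofReal x < genRadius κ ∧
      ∃ J, 1 < ∑ j ∈ Finset.Icc 1 J, κ j * x ^ j
  · obtain ⟨x, hx, hxR, J, hJ⟩ := hex
    obtain ⟨r, hr0, hrx, hr⟩ := exists_modDeriv_eq_one hκ hx hxR hJ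
    have hrR : ENNReal.ofReal r < genRadius κ := (ENNReal.ofReal_le_ofReal hrx).trans_lt hxR
    refine ⟨r, hr0, hrR.le, fun _ => hr, fun hlt => ?_⟩
    have hle : modDeriv κ 1 (ENNReal.ofReal r) ≤ modDeriv κ 1 (genRadius κ) :=
      ENNReal.tsum_le_tsum fun j => by gcongr
    rw [hr] at hle
    exact absurd hlt (not_lt.2 hle)
  · push Not at hex
    have hle : modDeriv κ 1 (genRadius κ) ≤ 1 := by
      refine modDeriv_le_of_forall_lt hR0 fun x hx => ?_
      have hxt : x ≠ ∞ := (hx.trans_le le_top).ne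
      rw [← ENNReal.ofReal_toReal hxt] at hx ⊢
      rcases (ENNReal.toReal_nonneg (a := x)).eq_or_lt with h0 | h0
      · rw [← h0]
        refine modDeriv_le_one hκ le_rfl fun J => ?_
        rw [Finset.sum_eq_zero]
        · exact zero_le_one
        · intro j hj
          rw [zero_pow (by have := (Finset.mem_Icc.1 hj).1; omega), mul_zero]
      · exact modDeriv_le_one hκ h0.le (hex _ h0 hx)
    have hRt : genRadius κ ≠ ∞ := by
      intro htop
      obtain ⟨j, hj1, hj⟩ := hpos
      -- At `x = 1 + 1 / κ_j ≥ 1` the single term `κ_j x ^ j ≥ κ_j x = κ_j + 1` already exceeds one.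
      have hx : (0 : ℝ) < 1 + 1 / κ j := by positivity
      have h1 := hex (1 + 1 / κ j) hx (htop ▸ ENNReal.ofReal_lt_top) j
      have h2 := Finset.single_le_sum (f := fun i => κ i * (1 + 1 / κ j) ^ i) (fun i hi => by
        have := hκ i (Finset.mem_Icc.1 hi).1
        positivity) (Finset.mem_Icc.2 ⟨hj1, le_rfl⟩)
      have h3 : 1 + 1 / κ j ≤ (1 + 1 / κ j) ^ j :=
        le_self_pow₀ (by have : 0 < 1 / κ j := by positivity
                         linarith) (by omega)
      have h4 : κ j * (1 + 1 / κ j) ≤ 1 :=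
        (mul_le_mul_of_nonneg_left h3 hj.le).trans (h2.trans h1)
      have h5 : κ j * (1 + 1 / κ j) = κ j + 1 := by field_simp
      linarith
    have hReal := ENNReal.ofReal_toReal hRt
    refine ⟨(genRadius κ).toReal, ENNReal.toReal_pos hR0.ne' hRt, hReal.le, fun h => ?_,
      fun _ => hReal⟩
    rw [hReal]
    exact le_antisymm hle h

lemma hasSum_limitWeight (hκ : ∀ j : ℕ, 1 ≤ j → 0 ≤ κ j) {r : ℝ} (h : IsRStar κ r) :
    HasSum (limitWeight κ r) (modDeriv κ 1 (ENNReal.ofReal r)).toReal := by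
  have hfin : ∑' j, ENNReal.ofReal (limitWeight κ r j) ≠ ∞ := by
    rw [← modDeriv_one_ofReal h.1.le]
    exact (h.modDeriv_le_one.trans_lt ENNReal.one_lt_top).ne
  have h1 := ENNReal.hasSum_toReal hfin
  rw [← ENNReal.tsum_toReal_eq (ENNReal.ne_top_of_tsum_ne_top hfin), ← modDeriv_one_ofReal h.1.le] at h1
  simpa only [ENNReal.toReal_ofReal (limitWeight_nonneg hκ h.1.le _)] using h1

lemma hasSum_pnat_of_hasSum_limitWeight {r S : ℝ} (h : HasSum (limitWeight κ r) S) :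
    HasSum (fun j : ℕ+ => κ j * r ^ (j : ℕ)) S := by
  have h1 := (PNat.coe_injective.hasSum_iff (f := limitWeight κ r) (a := S) (fun j hj => by
    have : j = 0 := by
      by_contra h0
      exact hj ⟨⟨j, Nat.pos_of_ne_zero h0⟩, rfl⟩
    exact if_pos this)).2 h
  refine h1.congr_fun fun j => ?_
  exact (if_neg j.ne_zero).symm

end

end SurrogateSpatial

end

/-! ### Limit law and asymptotic independence of the lexicographic cycle lengths -/

theorem mainTheorem8 (θ κ : ℕ → ℝ)
    (hθ : ∀ j : ℕ, 1 ≤ j → 0 ≤ θ j) (hκ : ∀ j : ℕ, 1 ≤ j → 0 ≤ κ j)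
    (hna : SurrogateSpatial.NonArithmetic κ) (hnd : ∃ j : ℕ, 2 ≤ j ∧ 0 < κ j)
    (han : SurrogateSpatial.AnalyticConditions θ κ) :
    -- for all large `N` the measure is well defined
    (∀ᶠ N : ℕ in atTop, 0 < SurrogateSpatial.normConst θ κ N) ∧
    -- `r` is the uniquely determined number `r_*`
    ∃ r : ℝ, (SurrogateSpatial.IsRStar κ r ∧ ∀ r' : ℝ, SurrogateSpatial.IsRStar κ r' → r' = r) ∧
      ∀ m : ℕ, 1 ≤ m →
        -- the limit of the joint distribution of `L_1, …, L_m`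
        (∀ ℓ : Fin m → ℕ+, Tendsto
          (fun N : ℕ => SurrogateSpatial.prob θ κ N
            {σ | ∀ i : Fin m, SurrogateSpatial.lexLength σ i = (ℓ i : ℕ)})
          atTop (𝓝 (∏ i : Fin m, κ (ℓ i : ℕ) * r ^ (ℓ i : ℕ)))) ∧
        -- asymptotic independence, conditionally on `L_1 ≤ M, …, L_m ≤ M`
        (∀ M : ℕ, (∃ j : ℕ, 1 ≤ j ∧ j ≤ M ∧ 0 < κ j) → ∀ ℓ : Fin m → ℕ+, Tendsto
          (fun N : ℕ =>
            SurrogateSpatial.condProb θ κ N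
                {σ | ∀ i : Fin m, SurrogateSpatial.lexLength σ i = (ℓ i : ℕ)}
                {σ | ∀ i : Fin m, SurrogateSpatial.lexLength σ i ≤ M}
              - ∏ i : Fin m, SurrogateSpatial.condProb θ κ N
                  {σ | SurrogateSpatial.lexLength σ i = (ℓ i : ℕ)}
                  {σ | ∀ k : Fin m, SurrogateSpatial.lexLength σ k ≤ M})
          atTop (𝓝 0)) ∧
        -- subcritical and critical cases: proper limit, unconditional asymptotic independence
        (1 ≤ SurrogateSpatial.modDeriv κ 1 (SurrogateSpatial.genRadius κ) →
          HasSum (fun ℓ : Fin m → ℕ+ => ∏ i : Fin m, κ (ℓ i : ℕ) * r ^ (ℓ i : ℕ)) 1 ∧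
          ∀ A : Fin m → Set ℕ, Tendsto
            (fun N : ℕ =>
              SurrogateSpatial.prob θ κ N {σ | ∀ i : Fin m, SurrogateSpatial.lexLength σ i ∈ A i}
                - ∏ i : Fin m, SurrogateSpatial.prob θ κ N
                    {σ | SurrogateSpatial.lexLength σ i ∈ A i})
            atTop (𝓝 0)) ∧
        -- supercritical case: defective limit
        (SurrogateSpatial.modDeriv κ 1 (SurrogateSpatial.genRadius κ) < 1 →
          HasSum (fun ℓ : Fin m → ℕ+ => ∏ i : Fin m, κ (ℓ i : ℕ) * r ^ (ℓ i : ℕ))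
            ((SurrogateSpatial.modDeriv κ 1 (SurrogateSpatial.genRadius κ)).toReal ^ m) ∧
          (SurrogateSpatial.modDeriv κ 1 (SurrogateSpatial.genRadius κ)).toReal ^ m < 1) := by
  have hpos : ∃ j : ℕ, 1 ≤ j ∧ 0 < κ j := by
    obtain ⟨j, hj, hj0⟩ := hnd
    exact ⟨j, by omega, hj0⟩
  obtain ⟨hR0, hRθ⟩ := han.radius
  obtain ⟨r, hr⟩ := SurrogateSpatial.exists_isRStar hκ hpos hR0
  have hcr := hr.isCriticalRadius hθ hκ hRθ
  refine ⟨SurrogateSpatial.eventually_normConst_pos hθ hκ hna hcr, r,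
    ⟨hr, fun r' hr' => hr.unique hκ hr'⟩, fun m hm => ⟨fun ℓ => ?_, fun M hM ℓ => ?_,
      fun h1 => ⟨?_, fun A => ?_⟩, fun h1 => ⟨?_, ?_⟩⟩⟩
  · have h2 := SurrogateSpatial.tendsto_prob_lexLength_eq hθ hκ hna hcr (fun i => (ℓ i : ℕ))
    have h3 : ∀ i, SurrogateSpatial.limitWeight κ r (ℓ i : ℕ) = κ (ℓ i : ℕ) * r ^ (ℓ i : ℕ) :=
      fun i => if_neg (ℓ i).ne_zero
    simpa only [h3] using h2
  · exact SurrogateSpatial.tendsto_condProb_sub_prod hθ hκ hna hcr hM (fun i => (ℓ i : ℕ))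
  · have h2 := SurrogateSpatial.hasSum_limitWeight hκ hr
    rw [hr.2.2.1 h1, ENNReal.toReal_one] at h2
    have h3 := SurrogateSpatial.hasSum_prod_pow (fun j : ℕ+ => mul_nonneg (hκ j j.2)
      (pow_nonneg hr.1.le _)) (SurrogateSpatial.hasSum_pnat_of_hasSum_limitWeight h2) m
    rwa [one_pow] at h3
  · have h2 := SurrogateSpatial.hasSum_limitWeight hκ hr
    rw [hr.2.2.1 h1, ENNReal.toReal_one] at h2
    exact SurrogateSpatial.tendsto_prob_sub_prod hθ hκ hna hcr h2 A
  · have h2 := SurrogateSpatial.hasSum_limitWeight hκ hr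
    rw [hr.2.2.2 h1] at h2
    exact SurrogateSpatial.hasSum_prod_pow (fun j : ℕ+ => mul_nonneg (hκ j j.2)
      (pow_nonneg hr.1.le _)) (SurrogateSpatial.hasSum_pnat_of_hasSum_limitWeight h2) m
  · refine pow_lt_one₀ ENNReal.toReal_nonneg ?_ (by omega)
    rw [← ENNReal.toReal_one]
    exact (ENNReal.toReal_lt_toReal (h1.trans ENNReal.one_lt_top).ne ENNReal.one_ne_top).2 h1
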